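/- Let $K$ be a field, and let $\omega$ be a feasible exponent of matrix multiplication over $K$: there is a constant $C_0$ such that, for every $s\ge 1$, two $s\times s$ matrices over any commutative $K$-algebra can be multiplied with at most $C_0 s^{\omega}$ arithmetic operations, by a straight-line program over $K$ depending only on $s$. (A straight-line program over $K$ is a finite sequence of additions, subtractions, multiplications and divisions applied to inputs, constants of $K$ and previous results; divisors must be invertible; its cost is the number of operations.) For $f\in K[x]$ of degree $n$, $a\in K[x]$ with $\deg a<n$ and an integer $\mu$, let $$\mathcal N_\mu=\{p\in K[x,y] : \deg_y p<\mu,\ p(x,a)\equiv 0 \bmod f\},$$ a free $K[x]$-module of rank $\mu$. A minimal basis of $\mathcal N_\mu$ is a matrix $R\in K[x]^{\mu\times\mu}$ without zero columns whose columns are the coefficient vectors (with respect to $1,y,\dots,y^{\mu-1}$) of a basis of $\mathcal N_\mu$, and which is column reduced: $\deg\det R$ is the sum over the columns of the maximal degree of the entries of the column. Its degree is the maximal degree of its entries. Then there are constants $C$ and $c$, depending only on $K$ and $\omega$, such that for all integers $n,m,d,\mu,\delta\ge 0$ with $d^{1/3}\le\mu\le n$ there is a straight-line program over $K$ of cost at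 most $$C\,\mu^{\omega}(\delta+m\mu)\,\log(n+2)^{c}$$ (that is, $\tilde O(\mu^{\omega}(\delta+m\mu))$ operations in $K$) with the following property. Let $f\in K[x]$ have degree $n$, let $a,b\in K[x]$ have degree less than $n$, suppose that $\mathcal N_\mu$ has a minimal basis of degree $\delta$, and let $A_j,B_j\in K[x,y]$ $(0\le j<\mu)$ have $x$-degree less than $\delta$ and $y$-degree less than $\mu$ and satisfy $$A_j(x,a)\equiv a^{j\mu}\bmod f,\qquad B_j(x,a)\equiv a^{j\mu^2}\bmod f .$$ Given the coefficients of $f$, $a$, $b$, the $A_j$ and the $B_j$, the program performs no division by zero and returns the truncations $[b a^k \operatorname{rem} f]_0^{m-1}$ for all $0\le k<d$, that is, the coefficients of $x^0,\dots,x^{m-1}$ in the remainder of $ba^k$ in the Euclidean division by $f$. -/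

import Mathlib

open Polynomial

universe u

/-! ### Straight-line programs: the algebraic model of computation over a field -/

/-- The four arithmetic operations. -/
inductive ArithOp where
  | add
  | sub
  | mul
  | div

/-- An operand is an input (indexed by `ι`), a constant of `K`, or the result of the `r`-th
instruction (counting from `0`). -/
inductive Operand (K ι : Type*) where
  | input (i : ι)
  | const (c : K)
  | reg (r : ℕ)

/-- An instruction applies one arithmetic operation to two operands. -/
structure Instr (K ι : Type*) where
  op : ArithOp
  fst : Operand K ι
  snd : Operand K ι

/-- A straight-line program with inputs indexed by `ι` and outputs indexed by `κ`. -/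
structure SLP (K ι κ : Type*) where
  instrs : List (Instr K ι)
  output : κ → Operand K ι

section SLPSemantics

variable {K ι κ : Type*} [CommSemiring K] {A : Type*} [CommRing A] [Algebra K A]

/-- Value of an operand; undefined for a result that has not been computed yet. -/
def Operand.value (inp : ι → A) (regs : List A) : Operand K ι → Option A
  | .input i => some (inp i)
  | .const c => some (algebraMap K A c)
  | .reg r => regs[r]?

open Classical in
/-- Result of an operation; a division is defined only when the divisor is invertible
(nonzero, if `A` is a field). -/
noncomputable def ArithOp.apply (x y : A) : ArithOp → Option A
  | .add => some (x + y)
  | .sub => some (x - y)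
  | .mul => some (x * y)
  | .div => if IsUnit y then some (x * Ring.inverse y) else none

/-- Result of an instruction, given the results `regs` of the preceding ones. -/
noncomputable def Instr.value (inp : ι → A) (regs : List A) (I : Instr K ι) : Option A :=
  (I.fst.value inp regs).bind fun x => (I.snd.value inp regs).bind fun y => I.op.apply x y

/-- Execute instructions one after the other, appending each result to the list of results. The
execution fails as soon as one instruction is undefined. -/
noncomputable def runInstrs (inp : ι → A) : List (Instr K ι) → List A → Option (List A)
  | [], regs => some regs
  | I :: Is, regs => (I.value inp regs).bind fun v => runInstrs inp Is (regs ++ [v])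

/-- On the input `inp` with values in the `K`-algebra `A`, the program runs without failure and
returns `out`. -/
def SLP.Computes (P : SLP K ι κ) (inp : ι → A) (out : κ → A) : Prop :=
  ∃ regs : List A, runInstrs inp P.instrs [] = some regs ∧
    ∀ k, (P.output k).value inp regs = some (out k)

end SLPSemantics

/-- The cost of a program: its number of arithmetic operations. -/
def SLP.cost {K ι κ : Type*} (P : SLP K ι κ) : ℕ := P.instrs.length

/-- `ω` is a feasible exponent of matrix multiplication over `K`: two `s × s` matrices over any
commutative `K`-algebra can be multiplied with `O(s ^ ω)` arithmetic operations, by a program that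
depends only on `s`. -/
def IsMatMulExponent (K : Type u) [Field K] (ω : ℝ) : Prop :=
  ∃ C : ℝ, ∀ s : ℕ, 0 < s →
    ∃ P : SLP K ((Fin s × Fin s) ⊕ (Fin s × Fin s)) (Fin s × Fin s),
      (P.cost : ℝ) ≤ C * (s : ℝ) ^ ω ∧
      ∀ (A : Type u) [CommRing A] [Algebra K A] (M N : Matrix (Fin s) (Fin s) A),
        P.Computes (Sum.elim (fun p => M p.1 p.2) (fun p => N p.1 p.2))
          (fun p => (M * N) p.1 p.2)

/-! ### Modules of relations and minimal bases

A bivariate polynomial is an element of `K[X][X]`: the outer variable is `y`, the coefficients are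
polynomials in `x`. Thus `p.eval a` is `p(x, a)`. -/

section Relations

variable {K : Type*} [Field K]

/-- The polynomials in `K[x,y]` of `x`-degree less than `s` and `y`-degree less than `t`. -/
def BidegreeLT (p : K[X][X]) (s t : ℕ) : Prop :=
  p.degree < (t : WithBot ℕ) ∧ ∀ k, (p.coeff k).degree < (s : WithBot ℕ)

/-- The `K[x]`-module of the polynomials `p` in `K[x,y]` of `y`-degree less than `μ` such that
`p(x, a) = 0 mod f`. -/
def relationModule (f a : K[X]) (μ : ℕ) : Submodule K[X] K[X][X] where
  carrier := {p | p.degree < (μ : WithBot ℕ) ∧ f ∣ p.eval a}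
  add_mem' := by
    rintro p q ⟨hp, hp'⟩ ⟨hq, hq'⟩
    refine ⟨lt_of_le_of_lt (degree_add_le p q) (max_lt hp hq), ?_⟩
    rw [eval_add]
    exact dvd_add hp' hq'
  zero_mem' := by
    refine ⟨?_, by simp⟩
    rw [degree_zero]
    exact WithBot.bot_lt_coe μ
  smul_mem' := by
    rintro c p ⟨hp, hp'⟩
    refine ⟨lt_of_le_of_lt (degree_smul_le c p) hp, ?_⟩
    rw [eval_smul, smul_eq_mul]
    exact Dvd.dvd.mul_left hp' c

variable {μ : ℕ}

/-- The polynomial `∑ i, R i j * y ^ i` whose coefficients are in the `j`-th column of `R`. -/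
noncomputable def colPoly (R : Matrix (Fin μ) (Fin μ) K[X]) (j : Fin μ) : K[X][X] :=
  ∑ i : Fin μ, monomial (i : ℕ) (R i j)

/-- Maximal degree of the entries of the `j`-th column. -/
noncomputable def colDegree (R : Matrix (Fin μ) (Fin μ) K[X]) (j : Fin μ) : ℕ :=
  Finset.univ.sup fun i => (R i j).natDegree

/-- Degree of a polynomial matrix: the maximal degree of its entries. -/
noncomputable def matDegree (R : Matrix (Fin μ) (Fin μ) K[X]) : ℕ :=
  Finset.univ.sup fun j => colDegree R j

/-- `R` has no zero column, and the degree of its determinant is the sum of its column degrees. -/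
def IsColumnReduced (R : Matrix (Fin μ) (Fin μ) K[X]) : Prop :=
  (∀ j, ∃ i, R i j ≠ 0) ∧ R.det.degree = ((∑ j, colDegree R j : ℕ) : WithBot ℕ)

/-- `R` is a minimal basis of the relation module: its columns form a basis of the module, and it
is column reduced. -/
def IsMinimalBasis (f a : K[X]) (R : Matrix (Fin μ) (Fin μ) K[X]) : Prop :=
  LinearIndependent K[X] (colPoly R) ∧
    Submodule.span K[X] (Set.range (colPoly R)) = relationModule f a μ ∧
    IsColumnReduced R

end Relations

/-! ### Input of the truncated powers problem -/

/-- Indices of the coefficients given as input: those of `f` (of degree `n`), of `a` and `b` (of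
degree less than `n`), and of the polynomials `A_j`, `B_j` for `j < μ`, where `A j i k` stands
for the coefficient of `x ^ i * y ^ k` in `A_j`. -/
inductive PowersInput (n μ δ : ℕ) where
  | f (i : Fin (n + 1))
  | a (i : Fin n)
  | b (i : Fin n)
  | A (j : Fin μ) (i : Fin δ) (k : Fin μ)
  | B (j : Fin μ) (i : Fin δ) (k : Fin μ)

/-- The coefficients of the given polynomials. -/
noncomputable def powersInput {K : Type*} [Field K] {n μ δ : ℕ} (f a b : K[X]) (A B : Fin μ → K[X][X]) :
    PowersInput n μ δ → K
  | .f i => f.coeff i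
  | .a i => a.coeff i
  | .b i => b.coeff i
  | .A j i k => ((A j).coeff k).coeff i
  | .B j i k => ((B j).coeff k).coeff i

/-! One program must serve all inputs. Let `Ω` be the set of all instances (`PowersInstance`). Each
input coefficient is a function on `Ω`, hence an element of the `K`-algebra `Ω → K`, and a
computation in this algebra specializes to every instance by evaluation (`SLP.Computes.map`). A unit
of `Ω → K` vanishes nowhere, so no specialization divides by zero. Costs are counted with the
relation `Known.Yields`, which hides registers; `Known.Yields.exists_slp` turns it into a program.

Write `s` for `μ`. Since `d ≤ s ^ 3`, each exponent is `k = i + j s + l s ^ 2` with digits below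
`s`, and `b a ^ k ≡ ∑ u, A_{j,u} E_{l,u+i}`, where `E_{l,t} ≡ ∑ v, B_{l,v} b a ^ (v+t)` modulo `f`.
The powers `b a ^ t rem f` for `t < 3 s` are computed in full. The minimal basis gives `n ≤ s δ`, so
these `3 s` modular products fit in the bound.

All later remainders are known only through their first `m` coefficients and the beginning of the
expansion of `h / f` at infinity (`residueSeries`). If `deg g < δ`, the product of the reversal of
`g` by this expansion contains both the quotient of `g h` by `f` and the expansion of `g h rem f`.
Thus `2 δ` residues of `h` give `δ` residues of the result, and `g h - f q` modulo `x ^ m` gives its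
low coefficients. The `E_{l,t}` for `t < 2 s` take two rounds of products of `s × s` matrices over
truncated series (`SeriesOpBound.linearCombination`).

The last step has `s ^ 3` outputs, too many for one product of precision `δ` per `l`. Only `m`
coefficients of each quotient matter, so sums of length `δ` are cut into blocks of length `m`, and
the dependence on `u + i` is a product in a second variable. The quotients become middle products in
one product of an `s × s D` by an `s D × s` matrix over bivariate series truncated at orders `2 s`
and `2 m`, where `m s D` is about `δ + m s` (`SeriesOpBound.quotients`). This costs `s ^ ω (δ + m
s)` up to logarithms.

The logarithms come from quasi-linear arithmetic of truncated series over an arbitrary `K`-algebra: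
multiplication by Fourier transforms modulo `X ^ N - 1` and Newton inversion.
`Known.Yields.truncate` then replaces each operation on series by operations on coefficients, so the
matrix programs apply to matrices of series. -/

/-! ### Sets of known values and what can be computed from them -/

/-- A set of known elements of a `K`-algebra; constants are always known. -/
structure Known (K V : Type*) [CommSemiring K] [CommRing V] [Algebra K V] where
  carrier : Set V
  const_mem' : ∀ c : K, algebraMap K V c ∈ carrier

namespace Known

section Basic

variable {K V : Type*} [CommSemiring K] [CommRing V] [Algebra K V]

instance : SetLike (Known K V) V where
  coe := carrier
  coe_injective := by rintro ⟨s, _⟩ ⟨t, _⟩ h; simpa using h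

instance : PartialOrder (Known K V) := .ofSetLike (Known K V) V

theorem const_mem (S : Known K V) (c : K) : algebraMap K V c ∈ S := S.const_mem' c

theorem zero_mem (S : Known K V) : (0 : V) ∈ S := by simpa using S.const_mem 0

theorem one_mem (S : Known K V) : (1 : V) ∈ S := by simpa using S.const_mem 1

/-- Add a set of elements. -/
def adj (S : Known K V) (T : Set V) : Known K V where
  carrier := S ∪ T
  const_mem' c := Or.inl (S.const_mem c)

theorem le_adj (S : Known K V) (T : Set V) : S ≤ S.adj T := fun _ hx => Or.inl hx

/-- The constants and the given elements. -/
def ofSet (T : Set V) : Known K V where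
  carrier := Set.range (algebraMap K V) ∪ T
  const_mem' c := Or.inl ⟨c, rfl⟩

/-- `S.Yields n T`: the elements of `T` can be computed from those of `S` with at most `n`
arithmetic operations. -/
inductive Yields : Known K V → ℕ → Set V → Prop
  | done {S : Known K V} {n : ℕ} {T : Set V} (h : ∀ x ∈ T, x ∈ S) : Yields S n T
  | step {S : Known K V} {n : ℕ} {T : Set V} {x y z : V} (o : ArithOp) (hx : x ∈ S) (hy : y ∈ S)
      (hz : o.apply x y = some z) (h : Yields (S.adj {z}) n T) : Yields S (n + 1) T

namespace Yields

variable {S S' : Known K V} {n n' : ℕ} {T T' U : Set V}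

theorem mono_left (h : S.Yields n T) (hS : S ≤ S') : S'.Yields n T := by
  induction h generalizing S' with
  | done h => exact done fun x hx => hS (h x hx)
  | step o hx hy hz _ ih =>
    refine step o (hS hx) (hS hy) hz (ih ?_)
    rintro w (hw | hw)
    exacts [Or.inl (hS hw), Or.inr hw]

theorem mono_cost (h : S.Yields n T) (hn : n ≤ n') : S.Yields n' T := by
  induction h generalizing n' with
  | done h => exact done h
  | step o hx hy hz _ ih =>
    obtain ⟨k, rfl⟩ : ∃ k, n' = k + 1 := ⟨n' - 1, by omega⟩
    exact step o hx hy hz (ih (by omega))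

theorem mono_right (h : S.Yields n T) (hT : T' ⊆ T) : S.Yields n T' := by
  induction h with
  | done h => exact done fun x hx => h x (hT hx)
  | step o hx hy hz _ ih => exact step o hx hy hz (ih hT)

/-- Continue a computation: the continuation may use all that was known or computed before. -/
theorem bind (h : S.Yields n T)
    (h' : ∀ S', S ≤ S' → (∀ x ∈ T, x ∈ S') → S'.Yields n' U) : S.Yields (n + n') U := by
  induction h with
  | done h => exact (h' _ le_rfl h).mono_cost (by omega)
  | @step S n T x y z o hx hy hz _ ih =>
    have := step o hx hy hz (ih fun S' hS hT => h' S' ((le_adj _ _).trans hS) hT)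
    exact this.mono_cost (by omega)

theorem mono_right_or (h : S.Yields n T) (hT : ∀ x ∈ T', x ∈ T ∨ x ∈ S) : S.Yields n T' := by
  have : S.Yields (n + 0) T' := h.bind fun S' hS hT' =>
    done fun x hx => (hT x hx).elim (hT' x) (hS ·)
  simpa using this

theorem union (h : S.Yields n T) (h' : S.Yields n' T') : S.Yields (n + n') (T ∪ T') := by
  refine h.bind (fun S' hS hT => ?_)
  have : S'.Yields (n' + 0) (T ∪ T') := (h'.mono_left hS).bind fun S'' hS' hT' =>
    done fun x hx => hx.elim (fun hx => hS' (hT x hx)) (hT' x)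
  simpa using this

theorem biUnion {ι : Type*} (s : Finset ι) {T : ι → Set V} (h : ∀ i ∈ s, S.Yields n (T i)) :
    S.Yields (s.card * n) {x | ∃ i ∈ s, x ∈ T i} := by
  classical
  induction s using Finset.induction_on with
  | empty => exact done (by simp)
  | insert a s ha ih =>
    have := (h a (by simp)).union (ih fun i hi => h i (by simp [hi]))
    rw [Finset.card_insert_of_notMem ha, add_mul, one_mul, add_comm]
    refine this.mono_right ?_
    rintro x ⟨i, hi, hx⟩
    rcases Finset.mem_insert.1 hi with rfl | hi
    exacts [Or.inl hx, Or.inr ⟨i, hi, hx⟩]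

/-- A family of `N` computations indexed by the natural numbers below `N`. -/
theorem range (N : ℕ) {T : ℕ → Set V} (h : ∀ i < N, S.Yields n (T i)) :
    S.Yields (N * n) {x | ∃ i < N, x ∈ T i} := by
  simpa using biUnion (Finset.range N) (T := T) (fun i hi => h i (by simpa using hi))

/-- A family of computations, each of which continues the preceding ones. -/
theorem iterate (N : ℕ) {T : ℕ → Set V}
    (h : ∀ i < N, ∀ S', S ≤ S' → (∀ j < i, ∀ x ∈ T j, x ∈ S') → S'.Yields n (T i)) :
    S.Yields (N * n) {x | ∃ i < N, x ∈ T i} := by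
  induction N with
  | zero => exact done (by simp)
  | succ N ih =>
    have h1 := (ih fun i hi => h i (by omega)).bind (n' := n)
      (U := {x | ∃ i < N + 1, x ∈ T i}) fun S' hS hT => by
        have := (h N (by omega) S' hS fun j hj x hx => hT x ⟨j, hj, hx⟩).bind (n' := 0)
          (U := {x | ∃ i < N + 1, x ∈ T i}) fun S'' hS' hT' => done ?_
        · simpa using this
        · rintro x ⟨i, hi, hx⟩
          rcases Nat.lt_succ_iff_lt_or_eq.1 hi with hi | rfl
          exacts [hS' (hT x ⟨i, hi, hx⟩), hT' x hx]
    rwa [add_mul, one_mul]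

theorem op {x y z : V} (o : ArithOp) (hx : x ∈ S) (hy : y ∈ S) (hz : o.apply x y = some z) :
    S.Yields 1 {z} :=
  step (n := 0) o hx hy hz (done fun _ h => Or.inr h)

theorem add {x y : V} (hx : x ∈ S) (hy : y ∈ S) : S.Yields 1 {x + y} := op .add hx hy rfl

theorem sub {x y : V} (hx : x ∈ S) (hy : y ∈ S) : S.Yields 1 {x - y} := op .sub hx hy rfl

theorem mul {x y : V} (hx : x ∈ S) (hy : y ∈ S) : S.Yields 1 {x * y} := op .mul hx hy rfl

theorem inv {y : V} (hy : y ∈ S) (hu : IsUnit y) : S.Yields 1 {Ring.inverse y} :=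
  op .div S.one_mem hy (by simp [ArithOp.apply, hu])

theorem sum {ι : Type*} (s : Finset ι) {g : ι → V} (h : ∀ i ∈ s, g i ∈ S) :
    S.Yields s.card {∑ i ∈ s, g i} := by
  classical
  induction s using Finset.induction_on with
  | empty => exact done (by simp [S.zero_mem])
  | insert a s ha ih =>
    rw [Finset.card_insert_of_notMem ha, Finset.sum_insert ha]
    exact (ih fun i hi => h i (by simp [hi])).bind fun S' hS hT =>
      add (hS (h a (by simp))) (hT _ rfl)

theorem sum_mul {ι : Type*} (s : Finset ι) {g h : ι → V} (hg : ∀ i ∈ s, g i ∈ S)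
    (hh : ∀ i ∈ s, h i ∈ S) : S.Yields (2 * s.card) {∑ i ∈ s, g i * h i} := by
  have h1 := biUnion s (T := fun i => {g i * h i}) (n := 1) fun i hi => mul (hg i hi) (hh i hi)
  refine (h1.bind (n' := s.card) fun S' hS hT => sum s fun i hi => hT _ ⟨i, hi, rfl⟩).mono_cost ?_
  omega

/-- At most `n` of the computed elements are new. -/
theorem card_le (h : S.Yields n T) (t : Finset V) (ht : ↑t ⊆ T) (hS : ∀ x ∈ t, x ∉ S) :
    t.card ≤ n := by
  classical
  induction h generalizing t with
  | @done S n T h =>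
    rw [Finset.card_eq_zero.2]
    · exact Nat.zero_le _
    · exact Finset.eq_empty_of_forall_notMem fun x hx => hS x hx (h x (ht hx))
  | @step S n T x y z o hx hy hz _ ih =>
    have := ih (t.erase z) (fun w hw => ht (Finset.mem_of_mem_erase hw)) (by
      intro w hw hw'
      rw [Finset.mem_erase] at hw
      rcases hw' with hw' | hw'
      exacts [hS w hw.2 hw', hw.1 hw'])
    have := Finset.pred_card_le_card_erase (s := t) (a := z)
    omega

end Yields

end Basic

end Known

/-! ### Straight-line programs and known values -/

section Programs

variable {K V ι κ : Type*} [CommSemiring K] [CommRing V] [Algebra K V]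

theorem Operand.value_mem {S : Known K V} {inp : ι → V} (hinp : ∀ i, inp i ∈ S) {regs : List V}
    (hregs : ∀ x ∈ regs, x ∈ S) {o : Operand K ι} {v : V} (h : o.value inp regs = some v) :
    v ∈ S := by
  cases o with
  | input i => cases h; exact hinp i
  | const c => cases h; exact S.const_mem c
  | reg r => exact hregs v (List.mem_of_getElem? h)

theorem runInstrs_yields {inp : ι → V} (P : List (Instr K ι)) {S : Known K V} {n : ℕ} {T : Set V}
    {regs regs' : List V} (hinp : ∀ i, inp i ∈ S) (hregs : ∀ x ∈ regs, x ∈ S)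
    (h : runInstrs inp P regs = some regs')
    (hT : ∀ S' : Known K V, S ≤ S' → (∀ x ∈ regs', x ∈ S') → S'.Yields n T) :
    S.Yields (P.length + n) T := by
  induction P generalizing S regs with
  | nil => cases h; simpa using hT S le_rfl hregs
  | cons I P ih =>
    simp only [runInstrs, Option.bind_eq_some_iff] at h
    obtain ⟨v, hv, h⟩ := h
    simp only [Instr.value, Option.bind_eq_some_iff] at hv
    obtain ⟨x, hx, y, hy, hv⟩ := hv
    have h1 := ih (S := S.adj {v}) (fun i => Or.inl (hinp i)) (by
      intro w hw
      rcases List.mem_append.1 hw with hw | hw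
      · exact Or.inl (hregs w hw)
      · exact Or.inr (by simpa using hw)) h
      fun S' hS hr => hT S' ((Known.le_adj _ _).trans hS) hr
    have := Known.Yields.step _ (Operand.value_mem hinp hregs hx) (Operand.value_mem hinp hregs hy)
      hv h1
    exact this.mono_cost (by simp [add_right_comm])

theorem SLP.Computes.yields {P : SLP K ι κ} {inp : ι → V} {out : κ → V} (h : P.Computes inp out)
    {S : Known K V} (hinp : ∀ i, inp i ∈ S) : S.Yields P.cost (Set.range out) := by
  obtain ⟨regs, hr, ho⟩ := h
  have := runInstrs_yields (n := 0) P.instrs (S := S) (T := Set.range out) hinp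
    (by simp) hr fun S' hS hregs => .done ?_
  · simpa [SLP.cost] using this
  · rintro _ ⟨k, rfl⟩
    exact Operand.value_mem (fun i => hS (hinp i)) hregs (ho k)

/-- An operand has to keep its value while later results are appended, hence the quantification over
all extensions `l` of the registers. -/
theorem Known.Yields.exists_instrs {inp : ι → V} {S : Known K V} {n : ℕ} {T : Set V}
    (h : S.Yields n T) (regs : List V)
    (hS : ∀ x ∈ S, ∃ o : Operand K ι, ∀ l, o.value inp (regs ++ l) = some x) :
    ∃ P : List (Instr K ι), P.length ≤ n ∧ ∃ regs', runInstrs inp P regs = some regs' ∧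
      ∀ x ∈ T, ∃ o : Operand K ι, o.value inp regs' = some x := by
  induction h generalizing regs with
  | done h =>
    refine ⟨[], Nat.zero_le _, regs, rfl, fun x hx => ?_⟩
    obtain ⟨o, ho⟩ := hS x (h x hx)
    exact ⟨o, by simpa using ho []⟩
  | @step S n T x y z o hx hy hz _ ih =>
    obtain ⟨ox, hox⟩ := hS x hx
    obtain ⟨oy, hoy⟩ := hS y hy
    obtain ⟨P, hP, regs', hr, hT⟩ := ih (regs ++ [z]) (by
      rintro w (hw | hw)
      · obtain ⟨ow, how⟩ := hS w hw
        exact ⟨ow, fun l => by simpa using how ([z] ++ l)⟩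
      · cases hw
        exact ⟨.reg regs.length, fun l => by simp [Operand.value]⟩)
    refine ⟨⟨o, ox, oy⟩ :: P, by simpa using hP, regs', ?_, hT⟩
    have h1 := hox []
    have h2 := hoy []
    rw [List.append_nil] at h1 h2
    simp [runInstrs, Instr.value, h1, h2, hz, hr]

theorem Known.Yields.exists_slp {inp : ι → V} {out : κ → V} {n : ℕ}
    (h : (Known.ofSet (Set.range inp) : Known K V).Yields n (Set.range out)) :
    ∃ P : SLP K ι κ, P.cost ≤ n ∧ P.Computes inp out := by
  obtain ⟨P, hP, regs, hr, hT⟩ := h.exists_instrs (inp := inp) [] (by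
    rintro x (⟨c, rfl⟩ | ⟨i, rfl⟩)
    exacts [⟨.const c, fun l => rfl⟩, ⟨.input i, fun l => rfl⟩])
  choose o ho using fun k => hT (out k) ⟨k, rfl⟩
  exact ⟨⟨P, o⟩, hP, regs, hr, ho⟩

variable {W : Type*} [CommRing W] [Algebra K W]

theorem Operand.value_map (φ : V →ₐ[K] W) {inp : ι → V} {regs : List V} {o : Operand K ι} {v : V}
    (h : o.value inp regs = some v) : o.value (φ ∘ inp) (regs.map φ) = some (φ v) := by
  cases o with
  | input i => cases h; rfl
  | const c => cases h; simp [Operand.value]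
  | reg r => simp only [Operand.value] at h ⊢; simp [h]

theorem ArithOp.apply_map (φ : V →ₐ[K] W) {x y z : V} {o : ArithOp} (h : o.apply x y = some z) :
    o.apply (φ x) (φ y) = some (φ z) := by
  cases o with
  | add => cases h; simp [ArithOp.apply]
  | sub => cases h; simp [ArithOp.apply]
  | mul => cases h; simp [ArithOp.apply]
  | div =>
    simp only [ArithOp.apply] at h ⊢
    split_ifs at h with hy
    obtain ⟨y, rfl⟩ := hy
    cases h
    rw [if_pos (y.isUnit.map φ)]
    have : φ ↑y = ((Units.map (φ : V →* W) y : Wˣ) : W) := rfl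
    rw [this, Ring.inverse_unit, map_mul, Ring.inverse_unit, ← map_inv]
    rfl

theorem runInstrs_map (φ : V →ₐ[K] W) {inp : ι → V} (P : List (Instr K ι)) {regs regs' : List V}
    (h : runInstrs inp P regs = some regs') :
    runInstrs (φ ∘ inp) P (regs.map φ) = some (regs'.map φ) := by
  induction P generalizing regs with
  | nil => cases h; rfl
  | cons I P ih =>
    simp only [runInstrs, Option.bind_eq_some_iff] at h
    obtain ⟨v, hv, h⟩ := h
    simp only [Instr.value, Option.bind_eq_some_iff] at hv
    obtain ⟨x, hx, y, hy, hv⟩ := hv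
    have := ih h
    rw [List.map_append] at this
    simp only [runInstrs, Instr.value, Operand.value_map φ hx, Operand.value_map φ hy,
      Option.bind_some, ArithOp.apply_map φ hv]
    exact this

/-- Homomorphisms send units to units, so defined divisions stay defined. Used with the evaluations
of `Ω → K` at points of `Ω`. -/
theorem SLP.Computes.map (φ : V →ₐ[K] W) {P : SLP K ι κ} {inp : ι → V} {out : κ → V}
    (h : P.Computes inp out) : P.Computes (φ ∘ inp) (φ ∘ out) := by
  obtain ⟨regs, hr, ho⟩ := h
  exact ⟨regs.map φ, runInstrs_map φ P.instrs hr, fun k => Operand.value_map φ (ho k)⟩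

end Programs

/-! ### Fast multiplication of polynomials -/

theorem Finset.sum_range_mul_eq_sum_sum {M : Type*} [AddCommMonoid M] (r L : ℕ) (f : ℕ → M) :
    ∑ j ∈ range (r * L), f j = ∑ c ∈ range r, ∑ j ∈ range L, f (r * j + c) := by
  rw [sum_comm]
  induction L with
  | zero => simp
  | succ L ih => rw [mul_add, mul_one, sum_range_add, ih, sum_range_succ]

section Fourier

variable {K V : Type*} [CommSemiring K] [CommRing V] [Algebra K V] {G : Type*} [AddCommGroup G]
  [Fintype G]

/-- The discrete Fourier transform over the group algebra of `G`, at the powers of a group element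
whose order divides `r ^ k`. -/
theorem Known.Yields.dft (r : ℕ) (hr : 0 < r) (k : ℕ) {S : Known K V} (s : G)
    (hs : (r ^ k) • s = 0) (p : ℕ → G → V) (hp : ∀ j < r ^ k, ∀ e, p j e ∈ S) :
    S.Yields (k * (r * (r ^ k * Fintype.card G)))
      {x | ∃ i : ℕ, ∃ e, ∑ j ∈ Finset.range (r ^ k), p j (e - (i * j) • s) = x} := by
  induction k generalizing S s p with
  | zero =>
    refine .done ?_
    rintro _ ⟨i, e, rfl⟩
    simpa using hp 0 (by simp) e
  | succ k ih =>
    have h1 := Known.Yields.range (S := S) r fun c hc =>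
      ih (r • s) (by rw [← mul_nsmul', ← pow_succ, hs]) (fun j => p (r * j + c)) fun j hj e =>
        hp _ (by
          calc r * j + c < r * (j + 1) := by rw [mul_add]; omega
            _ ≤ r * r ^ k := Nat.mul_le_mul_left _ hj
            _ = r ^ (k + 1) := by ring) e
    -- The radix-`r` step: sort the indices by their residue `c` modulo `r`. Twiddle factors are
    -- shifts of `e` and cost nothing.
    have key : ∀ (i : ℕ) (e : G), ∑ j ∈ Finset.range (r ^ (k + 1)), p j (e - (i * j) • s) =
        ∑ c ∈ Finset.range r, ∑ j ∈ Finset.range (r ^ k),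
          p (r * j + c) ((e - (i * c) • s) - (i * j) • r • s) := by
      intro i e
      rw [pow_succ, mul_comm, Finset.sum_range_mul_eq_sum_sum]
      refine Finset.sum_congr rfl fun c _ => Finset.sum_congr rfl fun j _ => ?_
      rw [sub_sub, ← mul_nsmul', ← add_nsmul]
      congr 3
      ring
    refine (h1.bind (n' := r ^ (k + 1) * Fintype.card G * r) fun S' hS hT => ?_).mono_cost
      (le_of_eq (by ring))
    have h2 := Known.Yields.biUnion (S := S') (n := r)
      (Finset.range (r ^ (k + 1)) ×ˢ (Finset.univ : Finset G))
      (T := fun q => {∑ j ∈ Finset.range (r ^ (k + 1)), p j (q.2 - (q.1 * j) • s)}) fun q _ => by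
        rw [key]
        simpa using Known.Yields.sum (S := S') (Finset.range r) fun c hc =>
          hT _ ⟨c, Finset.mem_range.1 hc, q.1, q.2 - (q.1 * c) • s, rfl⟩
    rw [Finset.card_product, Finset.card_range, Finset.card_univ] at h2
    refine h2.mono_right ?_
    rintro _ ⟨i, e, rfl⟩
    refine ⟨(i % r ^ (k + 1), e), by simp [Nat.mod_lt _ (pow_pos hr _)], ?_⟩
    simp only [Set.mem_singleton_iff]
    refine Finset.sum_congr rfl fun j _ => ?_
    congr 2
    conv_lhs => rw [← Nat.mod_add_div i (r ^ (k + 1))]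
    rw [add_mul, add_nsmul, mul_assoc, mul_comm (r ^ (k + 1)) (_ * _), mul_nsmul' _ _ (r ^ (k + 1)),
      hs, nsmul_zero, add_zero]

end Fourier

theorem Polynomial.eq_sum_monomial_of_degree_lt {R : Type*} [Semiring R] {p : R[X]} {N : ℕ}
    (hp : p.degree < N) : p = ∑ k ∈ Finset.range N, monomial k (p.coeff k) := by
  ext i
  simp only [finsetSum_coeff, coeff_monomial, Finset.sum_ite_eq', Finset.mem_range]
  split_ifs with h
  · rfl
  · exact coeff_eq_zero_of_degree_lt (hp.trans_le (by exact_mod_cast not_lt.1 h))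

/-! ### Polynomials modulo `X ^ N - 1` -/

section Cyclic

variable {V : Type*} [CommRing V] {N : ℕ}

variable (V N) in
/-- Reduction of a polynomial modulo `X ^ N - 1`. -/
noncomputable def cyclicReduce : V[X] →+* AddMonoidAlgebra V (ZMod N) :=
  (aeval (AddMonoidAlgebra.single (1 : ZMod N) (1 : V)) : V[X] →ₐ[V] _).toRingHom

theorem cyclicReduce_monomial (i : ℕ) (v : V) :
    cyclicReduce V N (monomial i v) = AddMonoidAlgebra.single (i : ZMod N) v := by
  simp [cyclicReduce, aeval_monomial, AddMonoidAlgebra.single_pow]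

variable (V) in
/-- The value at `X ^ i` of a polynomial over `V[X]`, reduced modulo `X ^ N - 1`. -/
noncomputable def cyclicEval (N : ℕ) (i : ℕ) : V[X][X] →+* AddMonoidAlgebra V (ZMod N) :=
  eval₂RingHom (cyclicReduce V N) (AddMonoidAlgebra.single (i : ZMod N) (1 : V))

theorem coeff_cyclicEval {P : V[X][X]} {L : ℕ} (hP : P.degree < L) (i : ℕ) (e : ZMod N) :
    (cyclicEval V N i P).coeff e =
      ∑ j ∈ Finset.range L, (cyclicReduce V N (P.coeff j)).coeff (e - (i * j) • (1 : ZMod N)) := by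
  conv_lhs => rw [eq_sum_monomial_of_degree_lt hP]
  simp only [map_sum, AddMonoidAlgebra.coeff_sum, cyclicEval, coe_eval₂RingHom, eval₂_monomial,
    AddMonoidAlgebra.single_pow, one_pow, Finsupp.finsetSum_apply,
    AddMonoidAlgebra.coeff_mul_single_apply, mul_one]
  refine Finset.sum_congr rfl fun j _ => ?_
  simp [sub_eq_add_neg, mul_comm]

variable [NeZero N]

theorem coeff_cyclicReduce {p : V[X]} {t : ℕ} (hp : p.degree < (N * t : ℕ)) (e : ZMod N) :
    (cyclicReduce V N p).coeff e = ∑ s ∈ Finset.range t, p.coeff (N * s + e.val) := by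
  classical
  conv_lhs => rw [eq_sum_monomial_of_degree_lt hp]
  rw [Finset.sum_range_mul_eq_sum_sum, map_sum]
  simp only [map_sum, cyclicReduce_monomial, AddMonoidAlgebra.coeff_sum,
    AddMonoidAlgebra.coeff_single, Finsupp.finsetSum_apply]
  rw [Finset.sum_eq_single e.val]
  · simp
  · intro c hc hce
    refine Finset.sum_eq_zero fun s _ => ?_
    rw [Finsupp.single_apply, if_neg]
    rintro rfl
    simp [ZMod.val_natCast, Nat.mod_eq_of_lt (Finset.mem_range.1 hc)] at hce
  · intro h
    exact absurd (Finset.mem_range.2 (ZMod.val_lt e)) h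

theorem coeff_cyclicReduce_of_degree_lt {p : V[X]} (hp : p.degree < N) (e : ZMod N) :
    (cyclicReduce V N p).coeff e = p.coeff e.val := by
  simpa using coeff_cyclicReduce (t := 1) (by simpa using hp) e

theorem ZMod.sum_range_natCast {M : Type*} [AddCommMonoid M] (g : ZMod N → M) :
    ∑ i ∈ Finset.range N, g i = ∑ i : ZMod N, g i := by
  refine Finset.sum_bij' (fun i _ => (i : ZMod N)) (fun i _ => i.val) ?_ ?_ ?_ ?_ ?_
  · simp
  · simp [ZMod.val_lt]
  · intro i hi
    simp [ZMod.val_natCast, Nat.mod_eq_of_lt (Finset.mem_range.1 hi)]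
  · simp
  · simp

/-- Every nonzero subgroup of a cyclic `r`-group contains the one of order `r`, here generated by `r
^ k`. -/
theorem ZMod.exists_mul_eq_prime_pow {N r k : ℕ} (hr : r.Prime) (hN : N = r ^ (k + 1)) {t : ZMod N}
    (ht : t ≠ 0) : ∃ i, i * t = (r ^ k : ℕ) := by
  subst hN
  have : NeZero (r ^ (k + 1)) := ⟨(pow_pos hr.pos _).ne'⟩
  obtain ⟨s, hs, hg⟩ := (Nat.dvd_prime_pow hr).1 (Nat.gcd_dvd_right t.val (r ^ (k + 1)))
  have hsk : s ≤ k := by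
    by_contra h
    obtain rfl : s = k + 1 := by omega
    have h1 := Nat.gcd_dvd_left t.val (r ^ (k + 1))
    rw [hg] at h1
    have h2 := Nat.le_of_dvd (Nat.pos_of_ne_zero fun h => ht ((ZMod.val_eq_zero t).1 h)) h1
    exact absurd (ZMod.val_lt t) (not_lt.2 h2)
  have hb := Nat.gcd_eq_gcd_ab t.val (r ^ (k + 1))
  rw [hg] at hb
  have hb' := congrArg (fun z : ℤ => (z : ZMod (r ^ (k + 1)))) hb
  refine ⟨((r ^ (k - s) : ℕ) : ZMod (r ^ (k + 1))) *
    ((Nat.gcdA t.val (r ^ (k + 1)) : ℤ) : ZMod (r ^ (k + 1))), ?_⟩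
  have h0 : (r : ZMod (r ^ (k + 1))) ^ (k + 1) = 0 := by
    exact_mod_cast ZMod.natCast_self (r ^ (k + 1))
  simp [h0] at hb'
  rw [mul_assoc, mul_comm _ t, ← hb']
  push_cast
  rw [← pow_add, Nat.sub_add_cancel hsk]

end Cyclic

section Cyclic

variable {V : Type*} [CommRing V]

/-- Some multiple of `t` is `r ^ k`, so the shift only permutes the terms. This replaces the
vanishing of sums of powers of a principal root of unity, which fails for `X` modulo `X ^ N - 1`. -/
theorem sum_coeff_add_mul_eq {N r k : ℕ} [NeZero N] (hr : r.Prime)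
    (hN : N = r ^ (k + 1)) (z : AddMonoidAlgebra V (ZMod N)) {t : ZMod N} (ht : t ≠ 0) (c : ℕ)
    (e : ZMod N) :
    ∑ i, z.coeff (e + (c * r ^ k : ℕ) + i * t) = ∑ i, z.coeff (e + i * t) := by
  obtain ⟨i₀, hi⟩ := ZMod.exists_mul_eq_prime_pow hr hN ht
  rw [← Equiv.sum_comp (Equiv.addRight (c * i₀)) fun i => z.coeff (e + i * t)]
  refine Finset.sum_congr rfl fun i _ => ?_
  rw [Equiv.coe_addRight, Nat.cast_mul, ← hi]
  congr 1
  ring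

/-- The coefficients of a bivariate polynomial, from the Fourier transform of its values. -/
theorem coeff_coeff_eq_of_cyclicEval {N r k : ℕ} [NeZero N] (hr : r.Prime)
    (hN : N = r ^ (k + 1)) {Z : V[X][X]} (hZ : Z.degree < N)
    (hZ' : ∀ j, (Z.coeff j).degree < ((r - 1) * r ^ k : ℕ)) {j e : ℕ} (hj : j < N)
    (he : e < (r - 1) * r ^ k) (U : ZMod N → V)
    (hU : ∀ e, U e = ∑ i ∈ Finset.range N, (cyclicEval V N i Z).coeff (e + (j * i : ℕ))) :
    (N : V) * (Z.coeff j).coeff e =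
      U (e : ℕ) - U ((e : ℕ) + ((r - 1 - e / r ^ k) * r ^ k : ℕ)) := by
  have hrk : 0 < r ^ k := pow_pos hr.pos k
  have hNr : (r - 1) * r ^ k + r ^ k = N := by
    rw [hN, pow_succ', ← Nat.succ_mul, Nat.succ_eq_add_one, Nat.sub_add_cancel hr.one_le]
  have hdeg : ∀ i, (Z.coeff i).degree < (N : ℕ) := fun i =>
    (hZ' i).trans (by exact_mod_cast (by omega))
  have hU' : ∀ e, U e = ∑ k' ∈ Finset.range N, ∑ i : ZMod N,
      (cyclicReduce V N (Z.coeff k')).coeff (e + i * ((j : ZMod N) - (k' : ℕ))) := by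
    intro e
    rw [hU, Finset.sum_comm, ← ZMod.sum_range_natCast]
    refine Finset.sum_congr rfl fun i _ => ?_
    rw [coeff_cyclicEval hZ]
    refine Finset.sum_congr rfl fun k' _ => ?_
    congr 1
    simp
    ring
  -- The index `k' = j` contributes `N` times a coefficient; the others are invariant under shifts
  -- by multiples of `r ^ k` and cancel in the difference.
  have hc : ∀ c, U (e : ℕ) - U ((e : ℕ) + (c * r ^ k : ℕ)) =
      N * ((cyclicReduce V N (Z.coeff j)).coeff (e : ℕ) -
        (cyclicReduce V N (Z.coeff j)).coeff ((e : ℕ) + (c * r ^ k : ℕ))) := by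
    intro c
    rw [hU', hU', ← Finset.sum_sub_distrib, Finset.sum_eq_single j]
    · simp [mul_sub]
    · intro k' hk' hne
      rw [sum_coeff_add_mul_eq hr hN, sub_self]
      intro h
      have h' := (ZMod.natCast_eq_natCast_iff' _ _ _).1 (sub_eq_zero.1 h)
      rw [Nat.mod_eq_of_lt hj, Nat.mod_eq_of_lt (Finset.mem_range.1 hk')] at h'
      exact hne h'.symm
    · intro h
      exact absurd (Finset.mem_range.2 hj) h
  have hq : e / r ^ k < r - 1 := Nat.div_lt_of_lt_mul (by rwa [mul_comm])
  have hdm := Nat.div_add_mod' e (r ^ k)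
  have hml := Nat.mod_lt e hrk
  -- The shift moves `e` into the last block, from `(r - 1) * r ^ k` to `N`, where the coefficients
  -- of `Z` vanish by the degree bound.
  have hsum : (r - 1 - e / r ^ k) * r ^ k + e / r ^ k * r ^ k = (r - 1) * r ^ k := by
    rw [← Nat.add_mul, Nat.sub_add_cancel hq.le]
  generalize e % r ^ k = y at hdm hml
  rw [hc, ← Nat.cast_add, coeff_cyclicReduce_of_degree_lt (hdeg j),
    coeff_cyclicReduce_of_degree_lt (hdeg j), ZMod.val_natCast, ZMod.val_natCast,
    Nat.mod_eq_of_lt (by omega), Nat.mod_eq_of_lt (by omega), sub_eq_self.2]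
  exact coeff_eq_zero_of_degree_lt ((hZ' j).trans_le (by exact_mod_cast (by omega)))

end Cyclic

/-! ### Recursive multiplication of polynomials -/

section Multiplication

variable (K V : Type*) [Field K] [CommRing V] [Algebra K V]

/-- The product of any two polynomials of degree less than `N` over `V` can be computed with `c`
operations. -/
def PolyMulCost (N c : ℕ) : Prop :=
  ∀ (S : Known K V) (p q : V[X]), p.degree < N → q.degree < N → (∀ i, p.coeff i ∈ S) →
    (∀ i, q.coeff i ∈ S) → S.Yields c {x | ∃ i, (p * q).coeff i = x}

variable {K V}

theorem Known.coeff_mem {S : Known K V} {p : V[X]} {N : ℕ} (hp : p.degree < N)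
    (h : ∀ i < N, p.coeff i ∈ S) (i : ℕ) : p.coeff i ∈ S := by
  rcases lt_or_ge i N with hi | hi
  · exact h i hi
  · rw [coeff_eq_zero_of_degree_lt (hp.trans_le (by exact_mod_cast hi))]
    exact S.zero_mem

theorem Polynomial.degree_mul_lt {R : Type*} [Semiring R] {p q : R[X]} {M N : ℕ}
    (hp : p.degree < M) (hq : q.degree < N) : (p * q).degree < (M + N : ℕ) := by
  rw [degree_lt_iff_coeff_zero] at *
  intro i hi
  rw [coeff_mul]
  refine Finset.sum_eq_zero fun x hx => ?_
  rw [Finset.HasAntidiagonal.mem_antidiagonal] at hx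
  rcases lt_or_ge x.1 M with h | h
  · rw [hq x.2 (by omega), mul_zero]
  · rw [hp x.1 h, zero_mul]

theorem PolyMulCost.cyclic {N c : ℕ} [NeZero N] (h : PolyMulCost K V N c) {S : Known K V}
    {x y : AddMonoidAlgebra V (ZMod N)} (hx : ∀ e, x.coeff e ∈ S) (hy : ∀ e, y.coeff e ∈ S) :
    S.Yields (c + N) {v | ∃ e, (x * y).coeff e = v} := by
  have key : ∀ x : AddMonoidAlgebra V (ZMod N), ∃ p : V[X], p.degree < N ∧
      cyclicReduce V N p = x ∧ ∀ i < N, p.coeff i = x.coeff i := by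
    intro x
    refine ⟨∑ e ∈ Finset.range N, monomial e (x.coeff e), ?_, ?_, ?_⟩
    · rw [degree_lt_iff_coeff_zero]
      intro m hm
      simp only [finsetSum_coeff, coeff_monomial, Finset.sum_ite_eq', Finset.mem_range]
      rw [if_neg (by omega)]
    · rw [map_sum]
      simp only [cyclicReduce_monomial]
      rw [ZMod.sum_range_natCast fun i => AddMonoidAlgebra.single i (x.coeff i)]
      ext e
      simp [AddMonoidAlgebra.coeff_sum]
    · intro i hi
      simp [finsetSum_coeff, coeff_monomial, hi]
  obtain ⟨p, hp, rfl, hpx⟩ := key x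
  obtain ⟨q, hq, rfl, hqy⟩ := key y
  refine (h S p q hp hq (Known.coeff_mem hp fun i hi => hpx i hi ▸ hx i)
    (Known.coeff_mem hq fun i hi => hqy i hi ▸ hy i)).bind fun S' hS hT => ?_
  have h1 := Known.Yields.biUnion (S := S') (n := 1) Finset.univ
    (T := fun e : ZMod N => {(cyclicReduce V N p * cyclicReduce V N q).coeff e}) fun e _ => by
      rw [← map_mul, coeff_cyclicReduce (t := 2) (by simpa [mul_two] using degree_mul_lt hp hq)]
      simp only [Finset.sum_range_succ, Finset.sum_range_zero, zero_add]
      exact Known.Yields.add (hT _ ⟨_, rfl⟩) (hT _ ⟨_, rfl⟩)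
  refine (h1.mono_cost (by simp [ZMod.card])).mono_right ?_
  rintro _ ⟨e, rfl⟩
  exact ⟨e, Finset.mem_univ _, rfl⟩

/-- Multiplication of bivariate polynomials by evaluation and interpolation at powers of `X`,
in the polynomials modulo `X ^ N - 1`. -/
theorem PolyMulCost.bivariate {N r k c : ℕ} (hr : r.Prime) (hrK : (r : K) ≠ 0)
    (hN : N = r ^ (k + 1)) (h : PolyMulCost K V N c) {S : Known K V} {P Q : V[X][X]} {B D : ℕ}
    (hD : D + D ≤ N) (hB : B + B ≤ (r - 1) * r ^ k)
    (hP : P.degree < D) (hQ : Q.degree < D)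
    (hP' : ∀ j, (P.coeff j).degree < B) (hQ' : ∀ j, (Q.coeff j).degree < B)
    (hPS : ∀ i j, (P.coeff j).coeff i ∈ S) (hQS : ∀ i j, (Q.coeff j).coeff i ∈ S) :
    S.Yields (N * c + (3 * r * (k + 1) + 3) * (N * N))
      {x | ∃ i j, ((P * Q).coeff j).coeff i = x} := by
  have hN0 : 0 < N := hN ▸ pow_pos hr.pos _
  have : NeZero N := ⟨hN0.ne'⟩
  have hrk : 0 < r ^ k := pow_pos hr.pos k
  have hNr : (r - 1) * r ^ k + r ^ k = N := by
    rw [hN, pow_succ', ← Nat.succ_mul, Nat.succ_eq_add_one, Nat.sub_add_cancel hr.one_le]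
  have hev : ∀ {S' : Known K V} {P : V[X][X]}, P.degree < D → (∀ j, (P.coeff j).degree < B) →
      (∀ i j, (P.coeff j).coeff i ∈ S') →
      S'.Yields ((k + 1) * (r * (N * N))) {x | ∃ i e, (cyclicEval V N i P).coeff e = x} := by
    intro S' P hP hP' hPS
    have h1 := Known.Yields.dft (S := S') r hr.pos (k + 1) (1 : ZMod N)
      (by rw [nsmul_eq_mul, mul_one, ← hN]; exact ZMod.natCast_self N)
      (fun j e => (cyclicReduce V N (P.coeff j)).coeff e) fun j _ e => by
        rw [coeff_cyclicReduce_of_degree_lt ((hP' j).trans (by exact_mod_cast (by omega)))]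
        exact hPS _ _
    rw [ZMod.card, ← hN] at h1
    refine h1.mono_right ?_
    rintro _ ⟨i, e, rfl⟩
    exact ⟨i, e, (coeff_cyclicEval (hP.trans (by exact_mod_cast (by omega))) i e).symm⟩
  have hZ : (P * Q).degree < (N : ℕ) :=
    (degree_mul_lt hP hQ).trans_le (by exact_mod_cast hD)
  have hZ' : ∀ j, ((P * Q).coeff j).degree < ((r - 1) * r ^ k : ℕ) := by
    intro j
    rw [coeff_mul]
    refine (degree_sum_le _ _).trans_lt ((Finset.sup_lt_iff (WithBot.bot_lt_coe _)).2 fun x _ => ?_)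
    exact (degree_mul_lt (hP' _) (hQ' _)).trans_le (by exact_mod_cast hB)
  have hinv : (algebraMap K V ((N : K)⁻¹)) * (N : V) = 1 := by
    rw [← map_natCast (algebraMap K V) N, ← map_mul, inv_mul_cancel₀, map_one]
    rw [hN, Nat.cast_pow]
    exact pow_ne_zero _ hrK
  refine ((hev hP hP' hPS).bind (n' := (k + 1) * (r * (N * N)) + (N * (c + N) +
    ((k + 1) * (r * (N * N)) + N * (N * 2)))) fun S₁ hS₁ hT₁ => ?_).mono_cost
      (le_of_eq (by ring))
  refine (hev hQ hQ' fun i j => hS₁ (hQS i j)).bind fun S₂ hS₂ hT₂ => ?_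
  refine (Known.Yields.range (S := S₂) N
    (T := fun i => {v | ∃ e, (cyclicEval V N i (P * Q)).coeff e = v})
    fun i hi => ?_).bind fun S₃ hS₃ hT₃ => ?_
  · rw [map_mul]
    exact h.cyclic (fun e => hS₂ (hT₁ _ ⟨i, e, rfl⟩)) (fun e => hT₂ _ ⟨i, e, rfl⟩)
  -- Interpolation is a transform at the powers of `X⁻¹`, followed by a difference and a
  -- multiplication by the constant `N⁻¹`.
  have h4 := Known.Yields.dft (S := S₃) r hr.pos (k + 1) (-1 : ZMod N)
      (by rw [nsmul_eq_mul, ← hN, ZMod.natCast_self N, zero_mul])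
      (fun i e => (cyclicEval V N i (P * Q)).coeff e) fun i hi e => hT₃ _ ⟨i, hN ▸ hi, e, rfl⟩
  rw [ZMod.card, ← hN] at h4
  refine h4.bind fun S₄ hS₄ hT₄ => ?_
  refine (Known.Yields.range (S := S₄) N
    (T := fun j => {v | ∃ i < N, ((P * Q).coeff j).coeff i = v})
    fun j hj => (Known.Yields.range (S := S₄) N (T := fun i => {((P * Q).coeff j).coeff i})
    fun i hi => ?_).mono_right ?_).mono_right_or ?_
  · rcases lt_or_ge i ((r - 1) * r ^ k) with hi' | hi'
    · have hx := coeff_coeff_eq_of_cyclicEval hr hN hZ hZ' hj hi'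
        (fun e => ∑ i ∈ Finset.range N, (cyclicEval V N i (P * Q)).coeff (e + (j * i : ℕ)))
        fun e => rfl
      have hm : ∀ e : ZMod N, ∑ i ∈ Finset.range N,
          (cyclicEval V N i (P * Q)).coeff (e + (j * i : ℕ)) ∈ S₄ := fun e =>
        hT₄ _ ⟨j, e, Finset.sum_congr rfl fun i _ => by simp⟩
      have hx' := congrArg (algebraMap K V ((N : K)⁻¹) * ·) hx
      simp only [← mul_assoc, hinv, one_mul] at hx'
      rw [hx']
      exact (Known.Yields.sub (hm _) (hm _)).bind fun S₅ hS₅ hT₅ =>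
        Known.Yields.mul (S₅.const_mem _) (hT₅ _ rfl)
    · refine .done fun x hx => ?_
      rw [hx, coeff_eq_zero_of_degree_lt ((hZ' j).trans_le (by exact_mod_cast hi'))]
      exact S₄.zero_mem
  · rintro _ ⟨i, hi, rfl⟩
    exact ⟨i, hi, rfl⟩
  · rintro _ ⟨i, j, rfl⟩
    rcases lt_or_ge j N with hj | hj
    · rcases lt_or_ge i N with hi | hi
      · exact Or.inl ⟨j, hj, i, hi, rfl⟩
      · rw [coeff_eq_zero_of_degree_lt ((hZ' j).trans_le (by exact_mod_cast (by omega)))]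
        exact Or.inr S₄.zero_mem
    · rw [coeff_eq_zero_of_degree_lt (hZ.trans_le (by exact_mod_cast hj)), coeff_zero]
      exact Or.inr S₄.zero_mem

theorem PolyMulCost.mono {N N' c c' : ℕ} (h : PolyMulCost K V N c) (hN : N' ≤ N) (hc : c ≤ c') :
    PolyMulCost K V N' c' := fun S p q hp hq hpS hqS =>
  (h S p q (hp.trans_le (by exact_mod_cast hN)) (hq.trans_le (by exact_mod_cast hN)) hpS
    hqS).mono_cost hc

theorem polyMulCost_naive (N : ℕ) : PolyMulCost K V N (8 * (N * N)) := by
  intro S p q hp hq hpS hqS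
  have h1 := Known.Yields.range (S := S) (n := 2 * (2 * N)) (2 * N)
    (T := fun i => {(p * q).coeff i}) fun i hi => by
      rw [coeff_mul]
      refine (Known.Yields.sum_mul _ (fun x _ => hpS _) fun x _ => hqS _).mono_cost ?_
      rw [Finset.Nat.card_antidiagonal]
      omega
  refine (h1.mono_cost (le_of_eq (by ring))).mono_right_or ?_
  rintro _ ⟨i, rfl⟩
  rcases lt_or_ge i (2 * N) with hi | hi
  · exact Or.inl ⟨i, hi, rfl⟩
  · rw [coeff_eq_zero_of_degree_lt ((degree_mul_lt hp hq).trans_le (by exact_mod_cast (by omega)))]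
    exact Or.inr S.zero_mem

/-- Cut a polynomial of degree less than `B * D` into `D` blocks of length `B`. -/
noncomputable def Polynomial.blocks (B D : ℕ) (p : V[X]) : V[X][X] :=
  ∑ j ∈ Finset.range D, monomial j (∑ i ∈ Finset.range B, monomial i (p.coeff (B * j + i)))

theorem Polynomial.coeff_blocks (B D : ℕ) (p : V[X]) (j i : ℕ) :
    ((blocks B D p).coeff j).coeff i = if j < D ∧ i < B then p.coeff (B * j + i) else 0 := by
  simp only [blocks, finsetSum_coeff, coeff_monomial, Finset.sum_ite_eq', Finset.mem_range]
  by_cases h : j < D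
  · simp [h, finsetSum_coeff, coeff_monomial]
  · simp [h]

theorem Polynomial.eval_blocks {B D : ℕ} {p : V[X]} (hp : p.degree < (B * D : ℕ)) :
    (blocks B D p).eval (X ^ B) = p := by
  conv_rhs => rw [eq_sum_monomial_of_degree_lt hp, Finset.sum_range_mul_eq_sum_sum, Finset.sum_comm]
  simp only [blocks, eval_finsetSum, eval_monomial, ← pow_mul, Finset.sum_mul, monomial_mul_X_pow]
  refine Finset.sum_congr rfl fun j _ => Finset.sum_congr rfl fun i _ => ?_
  rw [add_comm i]

/-- With `y = X ^ B`, a polynomial becomes a bivariate one with `D` coefficients of length `B`,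
where `B * D` is the original length. The bivariate product needs `r ^ (b + 2)` products of that
same length, about the square root of the original one. -/
theorem PolyMulCost.recursion {r b c : ℕ} (hr : r.Prime) (hrK : (r : K) ≠ 0)
    (h : PolyMulCost K V (r ^ (b + 2)) c) :
    PolyMulCost K V (r ^ (2 * b + 1)) (r ^ (b + 2) * c +
      (3 * r * (b + 2) + 3) * (r ^ (b + 2) * r ^ (b + 2)) + 4 * r ^ (2 * b + 1)) := by
  intro S p q hp hq hpS hqS
  set B := r ^ b with hB
  set D := r ^ (b + 1) with hD
  have hB0 : 0 < B := pow_pos hr.pos _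
  have hDB : D = r * B := pow_succ' _ _
  have hND : r ^ (b + 2) = r * D := pow_succ' _ _
  have hBD : r ^ (2 * b + 1) = B * D := by rw [hB, hD]; ring
  rw [hBD] at hp hq
  have hdeg : ∀ p : V[X], (blocks B D p).degree < D := fun p => by
    rw [degree_lt_iff_coeff_zero]
    intro j hj
    ext i
    rw [coeff_blocks, if_neg (by omega), coeff_zero]
  have hdeg' : ∀ (p : V[X]) (j : ℕ), ((blocks B D p).coeff j).degree < B := fun p j => by
    rw [degree_lt_iff_coeff_zero]
    intro i hi
    rw [coeff_blocks, if_neg (by omega)]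
  have hmem : ∀ p : V[X], (∀ i, p.coeff i ∈ S) → ∀ i j, ((blocks B D p).coeff j).coeff i ∈ S := by
    intro p hp i j
    rw [coeff_blocks]
    split_ifs
    exacts [hp _, S.zero_mem]
  have h2 := hr.two_le
  have h1 := h.bivariate hr hrK (k := b + 1) rfl (B := B) (D := D)
    (by rw [hND]; nlinarith)
    (by
      rw [← hD, hDB]
      calc B + B = 1 * (2 * B) := by ring
        _ ≤ (r - 1) * (r * B) := Nat.mul_le_mul (by omega) (Nat.mul_le_mul_right _ h2))
    (hdeg p) (hdeg q) (hdeg' p) (hdeg' q) (hmem p hpS) (hmem q hqS)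
  refine h1.bind fun S' hS hT => ?_
  have h3 := Known.Yields.range (S := S') (n := 2) (2 * (B * D))
    (T := fun i => {(p * q).coeff i}) fun i hi => by
      rw [← eval_blocks hp, ← eval_blocks hq, ← eval_mul]
      set Z := blocks B D p * blocks B D q with hZ
      have hZ' : ∀ j, (Z.coeff j).degree < (2 * B : ℕ) := by
        intro j
        rw [hZ, coeff_mul]
        refine (degree_sum_le _ _).trans_lt
          ((Finset.sup_lt_iff (WithBot.bot_lt_coe _)).2 fun x _ => ?_)
        rw [two_mul]
        exact degree_mul_lt (hdeg' p _) (hdeg' q _)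
      have hZd : Z.degree < (D + D : ℕ) := degree_mul_lt (hdeg p) (hdeg q)
      have hs : (Z.eval (X ^ B)).coeff i = ∑ j ∈ (Finset.range (D + D)).filter
          (fun j => B * j ≤ i ∧ i < B * j + 2 * B), (Z.coeff j).coeff (i - B * j) := by
        conv_lhs => rw [eq_sum_monomial_of_degree_lt hZd]
        simp only [eval_finsetSum, eval_monomial, ← pow_mul, finsetSum_coeff, coeff_mul_X_pow']
        rw [Finset.sum_filter]
        refine Finset.sum_congr rfl fun j _ => ?_
        by_cases h1 : B * j ≤ i
        · by_cases h2 : i < B * j + 2 * B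
          · simp [h1, h2]
          · rw [if_pos h1, if_neg (by omega)]
            exact coeff_eq_zero_of_degree_lt ((hZ' j).trans_le (by exact_mod_cast (by omega)))
        · simp [h1]
      rw [hs]
      refine (Known.Yields.sum _ fun j _ => hT _ ⟨_, _, rfl⟩).mono_cost ?_
      -- Product blocks have length less than `2 * B` and start at multiples of `B`, so at most two
      -- of them overlap at `i`.
      refine (Finset.card_le_card (t := {i / B, i / B - 1}) ?_).trans Finset.card_le_two
      intro j hj
      simp only [Finset.mem_filter] at hj
      have e1 : j ≤ i / B := (Nat.le_div_iff_mul_le hB0).2 (by rw [mul_comm]; exact hj.2.1)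
      have e2 : i / B < j + 2 := (Nat.div_lt_iff_lt_mul hB0).2 (by
        rw [add_mul, mul_comm j]; exact hj.2.2)
      simp only [Finset.mem_insert, Finset.mem_singleton]
      omega
  refine (h3.mono_cost (by rw [hBD]; omega)).mono_right_or ?_
  rintro _ ⟨i, rfl⟩
  rcases lt_or_ge i (2 * (B * D)) with hi | hi
  · exact Or.inl ⟨i, hi, rfl⟩
  · rw [coeff_eq_zero_of_degree_lt ((degree_mul_lt hp hq).trans_le (by exact_mod_cast (by omega)))]
    exact Or.inr S'.zero_mem

/-- The recursion roughly halves `k` while the cost per coefficient grows by at most `162`,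
including overhead. A power of `k` absorbs this constant; the exponent `12` is large enough, not
optimal. -/
theorem polyMulCost_prime_pow {r : ℕ} (hr : r.Prime) (hr3 : r ≤ 3) (hrK : (r : K) ≠ 0) (k : ℕ)
    (hk : 0 < k) : PolyMulCost K V (r ^ k) (r ^ k * (8 * 3 ^ 20 * k ^ 12)) := by
  obtain ⟨G, hG⟩ : ∃ G : ℕ, G = 8 * 3 ^ 20 := ⟨_, rfl⟩
  rw [← hG]
  induction k using Nat.strong_induction_on with
  | _ k ih =>
  rcases lt_or_ge k 20 with hk20 | hk20
  · refine (polyMulCost_naive _).mono le_rfl ?_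
    have h1 : r ^ k ≤ 3 ^ 20 :=
      (Nat.pow_le_pow_left hr3 k).trans (Nat.pow_le_pow_right (by norm_num) hk20.le)
    have h2 : 1 ≤ k ^ 12 := Nat.one_le_pow _ _ hk
    calc 8 * (r ^ k * r ^ k) = r ^ k * (8 * r ^ k) := by ring
      _ ≤ r ^ k * (G * 1) := Nat.mul_le_mul_left _ (by omega)
      _ ≤ _ := by gcongr
  · obtain ⟨b, hb1, hb2⟩ : ∃ b, k ≤ 2 * b + 1 ∧ 2 * b ≤ k := ⟨k / 2, by omega, by omega⟩
    have h1 := (ih (b + 2) (by omega) (by omega)).recursion hr hrK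
    refine h1.mono (Nat.pow_le_pow_right hr.pos hb1) ?_
    -- `5 * (b + 2) ≤ 3 * k` holds from `k = 20` on, which explains the threshold, and `(5 / 3) ^ 12
    -- > 162`.
    have h5 : 5 ^ 12 * (b + 2) ^ 12 ≤ 3 ^ 12 * k ^ 12 := by
      rw [← mul_pow, ← mul_pow]
      exact Nat.pow_le_pow_left (by omega) 12
    have hX : b + 2 ≤ (b + 2) ^ 12 := Nat.le_self_pow (by norm_num) _
    have hr4 : r ^ (b + 2) * r ^ (b + 2) ≤ 81 * r ^ k := by
      calc r ^ (b + 2) * r ^ (b + 2) = r ^ (4 + 2 * b) := by ring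
        _ ≤ r ^ (4 + k) := Nat.pow_le_pow_right hr.pos (by omega)
        _ = r ^ 4 * r ^ k := pow_add _ _ _
        _ ≤ 3 ^ 4 * r ^ k := by gcongr
    have hr1 : r ^ (2 * b + 1) ≤ r ^ (b + 2) * r ^ (b + 2) := by
      rw [← pow_add]
      exact Nat.pow_le_pow_right hr.pos (by omega)
    generalize (b + 2) ^ 12 = x at *
    generalize k ^ 12 = y at *
    generalize r ^ (2 * b + 1) = w at *
    generalize r ^ (b + 2) = z at *
    have hrb : 3 * r * (b + 2) + 7 ≤ 16 * x := by nlinarith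
    calc z * (z * (G * x)) + (3 * r * (b + 2) + 3) * (z * z) + 4 * w
        ≤ z * (z * (G * x)) + (3 * r * (b + 2) + 3) * (z * z) + 4 * (z * z) := by gcongr
      _ = z * z * (G * x + (3 * r * (b + 2) + 7)) := by ring
      _ ≤ 81 * r ^ k * (G * x + 16 * x) := by gcongr
      _ ≤ 81 * r ^ k * (G * x + G * x) := by gcongr; omega
      _ = r ^ k * (G * (162 * x)) := by ring
      _ ≤ r ^ k * (G * y) := by gcongr; omega

end Multiplication

/-- Quasi-linear multiplication of polynomials over all algebras over a field. -/
theorem exists_polyMulCost (K : Type*) [Field K] : ∃ C : ℕ, ∀ N : ℕ, 0 < N →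
    ∀ (V : Type u) [CommRing V] [Algebra K V],
      PolyMulCost K V N (N * (C * (Nat.log 2 N + 1) ^ 12)) := by
  -- `2` and `3` cannot both vanish in `K`, so radix `3` serves in characteristic `2`.
  obtain ⟨r, hr, hr3, hrK⟩ : ∃ r : ℕ, r.Prime ∧ r ≤ 3 ∧ (r : K) ≠ 0 := by
    by_cases h : ((2 : ℕ) : K) = 0
    · refine ⟨3, Nat.prime_three, le_rfl, fun h3 => ?_⟩
      push_cast at h h3
      exact one_ne_zero (α := K) (by linear_combination h3 - h)
    · exact ⟨2, Nat.prime_two, by norm_num, h⟩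
  refine ⟨3 * (8 * 3 ^ 20), fun N hN V _ _ => ?_⟩
  have hlt := Nat.lt_pow_succ_log_self hr.one_lt N
  refine (polyMulCost_prime_pow hr hr3 hrK (Nat.log r N + 1) (Nat.succ_pos _)).mono hlt.le ?_
  have h1 : r ^ (Nat.log r N + 1) ≤ 3 * N := by
    rw [pow_succ']
    exact Nat.mul_le_mul hr3 (Nat.pow_log_le_self r hN.ne')
  have h2 : Nat.log r N ≤ Nat.log 2 N := Nat.log_anti_left (by norm_num) hr.two_le
  calc r ^ (Nat.log r N + 1) * (8 * 3 ^ 20 * (Nat.log r N + 1) ^ 12)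
      ≤ 3 * N * (8 * 3 ^ 20 * (Nat.log 2 N + 1) ^ 12) := by gcongr
    _ = _ := by ring

/-! ### Truncated power series -/

section Series

variable {K V : Type*} [Field K] [CommRing V] [Algebra K V]

theorem PolyMulCost.series {N c : ℕ} (h : PolyMulCost K V N c) {S : Known K V}
    {p q : PowerSeries V} (hp : ∀ i < N, PowerSeries.coeff i p ∈ S)
    (hq : ∀ i < N, PowerSeries.coeff i q ∈ S) :
    S.Yields c {x | ∃ i < N, PowerSeries.coeff i (p * q) = x} := by
  have hd : ∀ p : PowerSeries V, (p.trunc N).degree < N := fun p => PowerSeries.degree_trunc_lt p N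
  have hm : ∀ p : PowerSeries V, (∀ i < N, PowerSeries.coeff i p ∈ S) →
      ∀ i, (p.trunc N).coeff i ∈ S := fun p hp i => by
    rw [PowerSeries.coeff_trunc]
    split_ifs with hi
    exacts [hp i hi, S.zero_mem]
  refine (h S _ _ (hd p) (hd q) (hm p hp) (hm q hq)).mono_right ?_
  rintro _ ⟨i, hi, rfl⟩
  refine ⟨i, ?_⟩
  rw [← Polynomial.coeff_coe, Polynomial.coe_mul]
  exact (PowerSeries.coeff_mul_eq_coeff_trunc_mul_trunc p q hi).symm

/-- Newton's step squares the error: `z - t * (2 - y * t) = y * (z - t) ^ 2`, where `t` is the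
truncation of `z`. -/
theorem PowerSeries.coeff_newton {V : Type*} [CommRing V] {y z : PowerSeries V} (hyz : y * z = 1)
    {N i : ℕ} (hi : i < 2 * N) :
    coeff i (((z.trunc N : V[X]) : PowerSeries V) *
      (2 - y * ((z.trunc N : V[X]) : PowerSeries V))) = coeff i z := by
  set t := ((z.trunc N : V[X]) : PowerSeries V) with ht
  have hd : (X : PowerSeries V) ^ N ∣ z - t := by
    rw [X_pow_dvd_iff]
    intro m hm
    rw [map_sub, ht, Polynomial.coeff_coe, coeff_trunc, if_pos hm, sub_self]
  have h2 : z - t * (2 - y * t) = y * (z - t) ^ 2 := by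
    linear_combination (2 * t - z) * hyz
  have h3 : (X : PowerSeries V) ^ (2 * N) ∣ z - t * (2 - y * t) := by
    rw [h2, mul_comm 2, pow_mul]
    exact (pow_dvd_pow_of_dvd hd 2).mul_left y
  have h4 := X_pow_dvd_iff.1 h3 i hi
  rw [map_sub, sub_eq_zero] at h4
  exact h4.symm

theorem Known.Yields.series_inv {τ k : ℕ} (h : ∀ N ≤ 2 ^ k, PolyMulCost K V N (N * τ))
    {S : Known K V} {y z : PowerSeries V} (hyz : y * z = 1)
    (hy : ∀ i < 2 ^ k, PowerSeries.coeff i y ∈ S) :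
    S.Yields (2 ^ k * (4 * τ + 2)) {x | ∃ i < 2 ^ k, PowerSeries.coeff i z = x} := by
  induction k with
  | zero =>
    have hu : PowerSeries.coeff 0 y * PowerSeries.coeff 0 z = 1 := by
      have := congrArg (PowerSeries.coeff 0) hyz
      simpa using this
    have hinv : Ring.inverse (PowerSeries.coeff 0 y) = PowerSeries.coeff 0 z := by
      rw [← Ring.inverse_mul_cancel_left _ (PowerSeries.coeff 0 z) (IsUnit.of_mul_eq_one _ hu), hu,
        mul_one]
    have h1 := Known.Yields.inv (hy 0 (by simp)) (IsUnit.of_mul_eq_one _ hu)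
    refine (h1.mono_cost (by simp)).mono_right ?_
    rintro _ ⟨i, hi, rfl⟩
    obtain rfl : i = 0 := by simpa using hi
    exact hinv.symm
  | succ k ih =>
    have hk : 2 ^ (k + 1) = 2 * 2 ^ k := pow_succ' _ _
    refine ((ih (fun N hN => h N (by omega)) fun i hi => hy i (by omega)).bind
      (n' := 2 ^ (k + 1) * τ + (2 ^ (k + 1) * 1 + 2 ^ (k + 1) * τ)) fun S₁ hS₁ hT₁ => ?_).mono_cost
        (le_of_eq (by rw [hk]; ring))
    have ht : ∀ i < 2 ^ (k + 1),
        PowerSeries.coeff i ((z.trunc (2 ^ k) : V[X]) : PowerSeries V) ∈ S₁ := by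
      intro i _
      rw [Polynomial.coeff_coe, PowerSeries.coeff_trunc]
      split_ifs with hi
      exacts [hT₁ _ ⟨i, hi, rfl⟩, S₁.zero_mem]
    refine ((h _ le_rfl).series (fun i hi => hS₁ (hy i hi)) ht).bind fun S₂ hS₂ hT₂ => ?_
    refine (Known.Yields.range (S := S₂) (2 ^ (k + 1)) (T := fun i =>
      {PowerSeries.coeff i (2 - y * ((z.trunc (2 ^ k) : V[X]) : PowerSeries V))}) fun i hi =>
      ?_).bind fun S₃ hS₃ hT₃ => ?_
    · rw [map_sub]
      refine Known.Yields.sub ?_ (hT₂ _ ⟨i, hi, rfl⟩)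
      have h2 : (2 : PowerSeries V) = PowerSeries.C (algebraMap K V 2) := by
        rw [map_ofNat, map_ofNat]
      rw [h2, PowerSeries.coeff_C]
      split_ifs
      exacts [S₂.const_mem 2, S₂.zero_mem]
    · refine ((h _ le_rfl).series (fun i hi => hS₃ (hS₂ (ht i hi)))
        fun i hi => hT₃ _ ⟨i, hi, rfl⟩).mono_right ?_
      rintro _ ⟨i, hi, rfl⟩
      exact ⟨i, hi, PowerSeries.coeff_newton hyz (by rwa [← hk])⟩

variable (K V) in
/-- Arithmetic operations in the ring of power series over `V`, truncated at order `N`, can be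
performed with `c` operations. -/
def SeriesOpCost (N c : ℕ) : Prop :=
  ∀ (S : Known K V) (o : ArithOp) (x y z : PowerSeries V), o.apply x y = some z →
    (∀ i < N, PowerSeries.coeff i x ∈ S) → (∀ i < N, PowerSeries.coeff i y ∈ S) →
    S.Yields c {v | ∃ i < N, PowerSeries.coeff i z = v}

theorem seriesOpCost_of_polyMulCost {τ N : ℕ} (hτ : 0 < τ)
    (h : ∀ M ≤ 2 * N, PolyMulCost K V M (M * τ)) : SeriesOpCost K V N (N * (13 * τ)) := by
  intro S o x y z hz hx hy
  have hN : N * 1 ≤ N * (13 * τ) := Nat.mul_le_mul_left _ (by omega)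
  cases o with
  | add =>
    cases hz
    refine ((Known.Yields.range N (T := fun i => {PowerSeries.coeff i (x + y)}) fun i hi =>
      ?_).mono_cost hN).mono_right fun v ⟨i, hi, e⟩ => ⟨i, hi, e.symm⟩
    rw [map_add]
    exact .add (hx i hi) (hy i hi)
  | sub =>
    cases hz
    refine ((Known.Yields.range N (T := fun i => {PowerSeries.coeff i (x - y)}) fun i hi =>
      ?_).mono_cost hN).mono_right fun v ⟨i, hi, e⟩ => ⟨i, hi, e.symm⟩
    rw [map_sub]
    exact .sub (hx i hi) (hy i hi)
  | mul =>
    cases hz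
    exact ((h N (by omega)).series hx hy).mono_cost (by gcongr; omega)
  | div =>
    simp only [ArithOp.apply] at hz
    split_ifs at hz with hu
    cases hz
    rcases Nat.eq_zero_or_pos N with rfl | hN0
    · exact .done (by simp)
    have hk : 2 ^ Nat.clog 2 N ≤ 2 * N := by
      rcases Nat.lt_or_ge N 2 with h1 | h1
      · obtain rfl : N = 1 := by omega
        simp
      · have h2 := Nat.pow_pred_clog_lt_self (b := 2) (by norm_num) h1
        have h3 : 0 < Nat.clog 2 N := Nat.clog_pos (by norm_num) h1
        obtain ⟨j, hj⟩ : ∃ j, Nat.clog 2 N = j + 1 := ⟨Nat.clog 2 N - 1, by omega⟩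
        rw [hj] at h2 ⊢
        simp only [Nat.pred_eq_sub_one, Nat.add_sub_cancel] at h2
        rw [pow_succ]
        omega
    have hN2 : N ≤ 2 ^ Nat.clog 2 N := Nat.le_pow_clog (by norm_num) N
    obtain ⟨w, hw⟩ := hu.exists_right_inv
    have hwi : Ring.inverse y = w := by
      rw [← Ring.inverse_mul_cancel_left _ w hu, hw, mul_one]
    -- Newton iteration reaches a power of two that may exceed `N`, while only `N` coefficients of
    -- `y` are known. Its truncation is inverted instead; the quotient is the same up to order `N`.
    have hy0 : IsUnit ((y.trunc N : V[X]) : PowerSeries V) := by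
      rw [PowerSeries.isUnit_iff_constantCoeff, ← PowerSeries.coeff_zero_eq_constantCoeff_apply,
        Polynomial.coeff_coe, PowerSeries.coeff_trunc, if_pos hN0,
        PowerSeries.coeff_zero_eq_constantCoeff_apply]
      exact PowerSeries.isUnit_iff_constantCoeff.1 hu
    obtain ⟨w', hw'⟩ := hy0.exists_right_inv
    have hd : (PowerSeries.X : PowerSeries V) ^ N ∣ y - ((y.trunc N : V[X]) : PowerSeries V) := by
      rw [PowerSeries.X_pow_dvd_iff]
      intro m hm
      rw [map_sub, Polynomial.coeff_coe, PowerSeries.coeff_trunc, if_pos hm, sub_self]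
    have hww : ∀ i < N, PowerSeries.coeff i (x * w') = PowerSeries.coeff i (x * w) := by
      intro i hi
      rw [← sub_eq_zero, ← map_sub]
      refine PowerSeries.X_pow_dvd_iff.1 ?_ i hi
      have e : x * w' - x * w = x * w * w' * (y - ((y.trunc N : V[X]) : PowerSeries V)) := by
        linear_combination x * w * hw' - x * w' * hw
      rw [e]
      exact hd.mul_left _
    rw [hwi]
    have h1 := Known.Yields.series_inv (S := S) (k := Nat.clog 2 N)
      (fun M hM => h M (hM.trans hk)) hw' fun i _ => by
        rw [Polynomial.coeff_coe, PowerSeries.coeff_trunc]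
        split_ifs with hi
        exacts [hy i hi, S.zero_mem]
    refine (h1.bind fun S₁ hS₁ hT₁ => (h N (by omega)).series (fun i hi => hS₁ (hx i hi))
      fun i hi => hT₁ _ ⟨i, hi.trans_le hN2, rfl⟩).mono_cost ?_ |>.mono_right ?_
    · calc 2 ^ Nat.clog 2 N * (4 * τ + 2) + N * τ ≤ 2 * N * (4 * τ + 2 * τ) + N * τ := by
            gcongr; omega
        _ = N * (13 * τ) := by ring
    · rintro _ ⟨i, hi, rfl⟩
      exact ⟨i, hi, hww i hi⟩

/-- Simulation of a computation with power series by one with their truncations. -/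
theorem Known.Yields.truncate {N c n : ℕ} (h : SeriesOpCost K V N c)
    {S : Known K (PowerSeries V)} {T : Set (PowerSeries V)} (hT : S.Yields n T) {S₀ : Known K V}
    (hS : ∀ s ∈ S, ∀ i < N, PowerSeries.coeff i s ∈ S₀) :
    S₀.Yields (n * c) {v | ∃ t ∈ T, ∃ i < N, PowerSeries.coeff i t = v} := by
  induction hT generalizing S₀ with
  | done h =>
    refine .done ?_
    rintro _ ⟨t, ht, i, hi, rfl⟩
    exact hS t (h t ht) i hi
  | step o hx hy hz _ ih =>
    refine ((h S₀ o _ _ _ hz (hS _ hx) (hS _ hy)).bind fun S₁ hS₁ hT₁ => ih (S₀ := S₁) ?_).mono_cost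
      (le_of_eq (by ring))
    rintro s (hs | rfl) i hi
    exacts [hS₁ (hS s hs i hi), hT₁ _ ⟨i, hi, rfl⟩]

theorem Known.coeff_mem_of_mem_ofSet {T : Set (PowerSeries V)} {N : ℕ} {S₀ : Known K V}
    (hT : ∀ s ∈ T, ∀ i < N, PowerSeries.coeff i s ∈ S₀) {s : PowerSeries V}
    (hs : s ∈ (Known.ofSet T : Known K (PowerSeries V))) : ∀ i < N, PowerSeries.coeff i s ∈ S₀ := by
  rcases hs with ⟨c, rfl⟩ | hs
  · intro i _
    rw [PowerSeries.algebraMap_apply, PowerSeries.coeff_C]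
    split_ifs
    exacts [S₀.const_mem c, S₀.zero_mem]
  · exact hT s hs

end Series

/-- Quasi-linear arithmetic of truncated power series over all algebras over a field. -/
theorem exists_seriesOpCost (K : Type*) [Field K] : ∃ C : ℕ, ∀ M N : ℕ, N ≤ M →
    ∀ (V : Type u) [CommRing V] [Algebra K V],
      SeriesOpCost K V N (N * (C * (Nat.log 2 M + 1) ^ 12)) := by
  obtain ⟨C, hC⟩ := exists_polyMulCost.{u} K
  refine ⟨13 * ((C + 1) * 2 ^ 12), fun M N hN V _ _ => ?_⟩
  have hlog : 1 ≤ (Nat.log 2 M + 1) ^ 12 := Nat.one_le_pow _ _ (Nat.succ_pos _)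
  have h1 : SeriesOpCost K V N (N * (13 * ((C + 1) * 2 ^ 12 * (Nat.log 2 M + 1) ^ 12))) := by
    refine seriesOpCost_of_polyMulCost (by positivity) fun m hm => ?_
    rcases Nat.eq_zero_or_pos m with rfl | hm0
    · simpa using polyMulCost_naive (K := K) (V := V) 0
    refine (hC m hm0 V).mono le_rfl (Nat.mul_le_mul_left _ ?_)
    have h2 : Nat.log 2 m ≤ Nat.log 2 M + 1 := by
      rcases Nat.eq_zero_or_pos M with rfl | hM
      · omega
      rw [← Nat.log_mul_base (by norm_num) hM.ne']
      exact Nat.log_mono_right (by omega)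
    calc C * (Nat.log 2 m + 1) ^ 12 ≤ (C + 1) * (2 * (Nat.log 2 M + 1)) ^ 12 := by
          gcongr <;> omega
      _ = _ := by rw [mul_pow]; ring
  have e : N * (13 * ((C + 1) * 2 ^ 12) * (Nat.log 2 M + 1) ^ 12) =
      N * (13 * ((C + 1) * 2 ^ 12 * (Nat.log 2 M + 1) ^ 12)) := by ring
  rw [e]
  exact h1

/-! ### Matrix multiplication -/

/-- Products of `s × s` matrices over `V` can be computed with `c` operations. -/
def MatMulCost (K V : Type*) [Field K] [CommRing V] [Algebra K V] (s c : ℕ) : Prop :=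
  ∀ (S : Known K V) (P Q : ℕ → ℕ → V), (∀ i < s, ∀ j < s, P i j ∈ S) →
    (∀ i < s, ∀ j < s, Q i j ∈ S) →
    S.Yields c {x | ∃ i < s, ∃ j < s, ∑ k ∈ Finset.range s, P i k * Q k j = x}

theorem matMulCost_of_computes {K V : Type*} [Field K] [CommRing V] [Algebra K V] {s : ℕ}
    {P : SLP K ((Fin s × Fin s) ⊕ (Fin s × Fin s)) (Fin s × Fin s)}
    (hP : ∀ M N : Matrix (Fin s) (Fin s) V,
      P.Computes (Sum.elim (fun p => M p.1 p.2) (fun p => N p.1 p.2))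
        (fun p => (M * N) p.1 p.2)) : MatMulCost K V s P.cost := by
  intro S M N hM hN
  have h := (hP (.of fun i j => M i j) (.of fun i j => N i j)).yields (S := S) (by
    rintro (⟨i, j⟩ | ⟨i, j⟩)
    exacts [hM i i.2 j j.2, hN i i.2 j j.2])
  refine h.mono_right ?_
  rintro _ ⟨i, hi, j, hj, rfl⟩
  refine ⟨(⟨i, hi⟩, ⟨j, hj⟩), ?_⟩
  simp [Matrix.mul_apply, Finset.sum_range]

/-- An outer product of well-chosen powers of `X` has `s * s` distinct entries, none of them known
at the start, and each operation produces one value. This lets the matrix cost absorb overheads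
quadratic in `s` without assuming `2 ≤ ω`. -/
theorem sq_le_of_matMulCost {K : Type*} [Field K] {s c : ℕ} (h : MatMulCost K K[X] s c) :
    s * s ≤ c := by
  classical
  rcases Nat.eq_zero_or_pos s with rfl | hs
  · simp
  have h1 := h (Known.ofSet {x | ∃ i < s, x = X ^ (i + 1) ∨ x = X ^ ((i + 1) * (s + 1))})
    (fun i k => if k = 0 then X ^ (i + 1) else 0)
    (fun k j => if k = 0 then X ^ ((j + 1) * (s + 1)) else 0)
    (fun i hi k _ => by
      split_ifs
      · exact Or.inr ⟨i, hi, Or.inl rfl⟩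
      · exact Known.zero_mem _)
    (fun k _ j hj => by
      split_ifs
      · exact Or.inr ⟨j, hj, Or.inr rfl⟩
      · exact Known.zero_mem _)
  have hinj : Set.InjOn (fun p : ℕ × ℕ => (X : K[X]) ^ (p.1 + 1 + (p.2 + 1) * (s + 1)))
      ↑(Finset.range s ×ˢ Finset.range s) := by
    rintro ⟨i, j⟩ hp ⟨i', j'⟩ hp' e
    simp only [Finset.coe_product, Finset.coe_range, Set.mem_prod, Set.mem_Iio] at hp hp'
    have e' := congrArg natDegree e
    simp only [natDegree_X_pow] at e'
    have e1 := congrArg (· % (s + 1)) e'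
    simp only [Nat.add_mul_mod_self_right] at e1
    rw [Nat.mod_eq_of_lt (by omega), Nat.mod_eq_of_lt (by omega)] at e1
    have e2 : (j + 1) * (s + 1) = (j' + 1) * (s + 1) := by omega
    have e3 := Nat.eq_of_mul_eq_mul_right (by omega) e2
    ext <;> simp <;> omega
  have h2 := h1.card_le ((Finset.range s ×ˢ Finset.range s).image
    fun p : ℕ × ℕ => (X : K[X]) ^ (p.1 + 1 + (p.2 + 1) * (s + 1))) ?_ ?_
  · rwa [Finset.card_image_of_injOn hinj, Finset.card_product, Finset.card_range] at h2
  · intro x hx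
    simp only [Finset.coe_image, Set.mem_image, Finset.mem_coe, Finset.mem_product,
      Finset.mem_range] at hx
    obtain ⟨⟨i, j⟩, ⟨hi, hj⟩, rfl⟩ := hx
    refine ⟨i, hi, j, hj, ?_⟩
    rw [Finset.sum_eq_single 0]
    · simp [pow_add]
    · intro k _ hk
      simp [hk]
    · intro h0
      exact absurd (Finset.mem_range.2 hs) h0
  · intro x hx
    simp only [Finset.mem_image, Finset.mem_product, Finset.mem_range] at hx
    obtain ⟨⟨i, j⟩, ⟨hi, hj⟩, rfl⟩ := hx
    simp only at hi hj ⊢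
    rintro (⟨c, hc⟩ | ⟨k, hk, hc | hc⟩)
    · have e := congrArg natDegree hc
      rw [natDegree_X_pow, algebraMap_eq, natDegree_C] at e
      omega
    · have e := congrArg natDegree hc
      simp only [natDegree_X_pow] at e
      nlinarith
    · have e := congrArg natDegree hc
      simp only [natDegree_X_pow] at e
      have e1 := congrArg (· % (s + 1)) e
      simp only [Nat.add_mul_mod_self_right, Nat.mul_mod_left] at e1
      rw [Nat.mod_eq_of_lt (by omega)] at e1
      omega

theorem IsMatMulExponent.exists_matMulCost {K : Type u} [Field K] {ω : ℝ}
    (hω : IsMatMulExponent K ω) : ∃ (C : ℝ) (c : ℕ → ℕ), ∀ s : ℕ, 0 < s →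
      (c s : ℝ) ≤ C * (s : ℝ) ^ ω ∧ s * s ≤ c s ∧
        ∀ (V : Type u) [CommRing V] [Algebra K V], MatMulCost K V s (c s) := by
  obtain ⟨C, hC⟩ := hω
  have h : ∀ s : ℕ, ∃ c : ℕ, 0 < s → (c : ℝ) ≤ C * (s : ℝ) ^ ω ∧ s * s ≤ c ∧
      ∀ (V : Type u) [CommRing V] [Algebra K V], MatMulCost K V s c := by
    intro s
    rcases Nat.eq_zero_or_pos s with rfl | hs
    · exact ⟨0, fun h => absurd h (lt_irrefl _)⟩
    · obtain ⟨P, hP, hP'⟩ := hC s hs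
      exact ⟨P.cost, fun _ => ⟨hP, sq_le_of_matMulCost (matMulCost_of_computes (hP' K[X])),
        fun V _ _ => matMulCost_of_computes (hP' V)⟩⟩
  choose c hc using h
  exact ⟨C, c, hc⟩

/-- Products of `s × s D` by `s D × s` matrices. -/
theorem MatMulCost.blocks {K V : Type*} [Field K] [CommRing V] [Algebra K V] {s c : ℕ}
    (h : MatMulCost K V s c) (D : ℕ) {S : Known K V} {P Q : ℕ → ℕ → V}
    (hP : ∀ i < s, ∀ j < s * D, P i j ∈ S) (hQ : ∀ i < s * D, ∀ j < s, Q i j ∈ S) :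
    S.Yields (D * (c + s * s))
      {x | ∃ i < s, ∃ j < s, ∑ k ∈ Finset.range (s * D), P i k * Q k j = x} := by
  have hlt : ∀ {β k}, β < D → k < s → s * β + k < s * D := fun {β k} hβ hk =>
    calc s * β + k < s * (β + 1) := by rw [mul_add]; omega
      _ ≤ s * D := Nat.mul_le_mul_left _ hβ
  refine ((Known.Yields.range (S := S) D fun β hβ => h S (fun i k => P i (s * β + k))
    (fun k j => Q (s * β + k) j) (fun i hi k hk => hP i hi _ (hlt hβ hk))
    (fun k hk j hj => hQ _ (hlt hβ hk) j hj)).bind (n' := s * (s * D)) fun S₁ hS₁ hT₁ =>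
      ?_).mono_cost (le_of_eq (by ring))
  refine (Known.Yields.range s (T := fun i => {x | ∃ j < s,
    ∑ k ∈ Finset.range (s * D), P i k * Q k j = x}) fun i hi =>
      (Known.Yields.range s (T := fun j => {∑ k ∈ Finset.range (s * D), P i k * Q k j})
        fun j hj => ?_).mono_right ?_).mono_right ?_
  · rw [Finset.sum_range_mul_eq_sum_sum, Finset.sum_comm]
    simpa using Known.Yields.sum (S := S₁) (Finset.range D) fun β hβ =>
      hT₁ _ ⟨β, Finset.mem_range.1 hβ, i, hi, j, hj, rfl⟩
  · rintro _ ⟨j, hj, rfl⟩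
    exact ⟨j, hj, rfl⟩
  · rintro _ ⟨i, hi, j, hj, rfl⟩
    exact ⟨i, hi, j, hj, rfl⟩

/-! ### Division by a monic polynomial and expansions at infinity -/

section Residues

/-- The power series with coefficients `p (s - 1), …, p 0`. -/
noncomputable def revSeries {R : Type*} [Semiring R] (s : ℕ) (p : ℕ → R) : PowerSeries R :=
  .mk fun i => if i < s then p (s - 1 - i) else 0

theorem coeff_revSeries_mul {R : Type*} [Semiring R] (s : ℕ) (p q : ℕ → R) (k : ℕ) :
    PowerSeries.coeff k (revSeries s p * .mk q) =
      ∑ u ∈ Finset.range s, p u * if s - 1 - u ≤ k then q (k - (s - 1 - u)) else 0 := by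
  rw [← Finset.sum_range_reflect, PowerSeries.coeff_mul,
    Finset.Nat.sum_antidiagonal_eq_sum_range_succ_mk, Nat.succ_eq_add_one]
  simp only [revSeries, PowerSeries.coeff_mk]
  have h1 : ∀ i ∈ Finset.range s, (p (s - 1 - i) *
      if s - 1 - (s - 1 - i) ≤ k then q (k - (s - 1 - (s - 1 - i))) else 0) =
      if i < k + 1 then p (s - 1 - i) * q (k - i) else 0 := by
    intro i hi
    rw [Finset.mem_range] at hi
    rw [show s - 1 - (s - 1 - i) = i by omega]
    by_cases h : i ≤ k
    · rw [if_pos h, if_pos (by omega)]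
    · rw [if_neg h, if_neg (by omega), mul_zero]
  rw [Finset.sum_congr rfl h1]
  simp only [ite_mul, zero_mul]
  rw [← Finset.sum_filter, ← Finset.sum_filter]
  refine Finset.sum_congr ?_ fun _ _ => rfl
  ext i
  simp [and_comm]

theorem coeff_revSeries_mul_add {R : Type*} [Semiring R] (s : ℕ) (p q : ℕ → R) (i : ℕ) :
    PowerSeries.coeff (s - 1 + i) (revSeries s p * .mk q) =
      ∑ u ∈ Finset.range s, p u * q (u + i) := by
  rw [coeff_revSeries_mul]
  refine Finset.sum_congr rfl fun u hu => ?_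
  rw [Finset.mem_range] at hu
  rw [if_pos (by omega), show s - 1 + i - (s - 1 - u) = u + i by omega]

variable {V : Type*} [CommRing V] {f : V[X]}

/-- The coefficient of `1 / X` in the expansion of `p / f` at infinity, where `f` is monic. -/
noncomputable def residueInf (f : V[X]) : V[X] →ₗ[V] V :=
  lcoeff V (f.natDegree - 1) ∘ₗ modByMonicHom f

theorem residueInf_apply (p : V[X]) : residueInf f p = (p %ₘ f).coeff (f.natDegree - 1) := rfl

theorem residueInf_mul_modByMonic (hf : f.Monic) (p q : V[X]) :
    residueInf f (q * (p %ₘ f)) = residueInf f (q * p) := by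
  have h : q * p = q * (p %ₘ f) + f * (q * (p /ₘ f)) := by
    conv_lhs => rw [← modByMonic_add_div p f]
    ring
  rw [h, map_add, residueInf_apply (f * _), mul_comm f, mul_self_modByMonic hf,
    coeff_zero, add_zero]

/-- The expansion of `h / f` at infinity. -/
noncomputable def residueSeries (f h : V[X]) : PowerSeries V :=
  .mk fun i => residueInf f (X ^ i * h)

/-- The upper part of the product, from index `δ - 1` on, is the expansion at infinity of `g * h /
f` without its polynomial part. -/
theorem coeff_revSeries_mul_residueSeries_add {g h : V[X]} {δ : ℕ} (hg : g.degree < δ) (i : ℕ) :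
    PowerSeries.coeff (δ - 1 + i) (revSeries δ g.coeff * residueSeries f h) =
      residueInf f (X ^ i * (g * h)) := by
  rw [residueSeries, coeff_revSeries_mul_add]
  conv_rhs => rw [eq_sum_monomial_of_degree_lt hg, Finset.sum_mul, Finset.mul_sum, map_sum]
  refine Finset.sum_congr rfl fun w _ => ?_
  rw [← smul_eq_mul, ← map_smul, ← C_mul_X_pow_eq_monomial, smul_eq_C_mul,
    show X ^ i * (C (g.coeff w) * X ^ w * h) = C (g.coeff w) * (X ^ (w + i) * h) by ring]

variable [Nontrivial V]

/-- Multiplication by `X` shifts the expansion at infinity of `p / f`, and the coefficient of `1 /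
X` enters the polynomial part. -/
theorem X_mul_divByMonic (hf : f.Monic) (hn : 0 < f.natDegree) (p : V[X]) :
    (X * p) /ₘ f = X * (p /ₘ f) + C (residueInf f p) := by
  refine (div_modByMonic_unique _ (X * (p %ₘ f) - C (residueInf f p) * f) hf ⟨?_, ?_⟩).1
  · conv_rhs => rw [← modByMonic_add_div p f]
    ring
  · rw [degree_eq_natDegree hf.ne_zero, degree_lt_iff_coeff_zero]
    have hd : (p %ₘ f).degree < f.natDegree := by
      rw [← degree_eq_natDegree hf.ne_zero]
      exact degree_modByMonic_lt p hf
    intro i hi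
    obtain ⟨i, rfl⟩ : ∃ j, i = j + 1 := ⟨i - 1, by omega⟩
    rw [coeff_sub, coeff_X_mul, coeff_C_mul]
    rcases hi.eq_or_lt with h | h
    · have h1 : f.coeff (i + 1) = 1 := by rw [← h]; exact hf
      rw [h1, residueInf_apply, h, Nat.add_sub_cancel, mul_one, sub_self]
    · rw [coeff_eq_zero_of_degree_lt (hd.trans_le (by exact_mod_cast (by omega))),
        coeff_eq_zero_of_natDegree_lt h, mul_zero, sub_zero]

theorem coeff_X_pow_mul_divByMonic (hf : f.Monic) (hn : 0 < f.natDegree) {h : V[X]}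
    (hh : h.degree < f.natDegree) (w e : ℕ) :
    ((X ^ w * h) /ₘ f).coeff e = if e < w then residueInf f (X ^ (w - 1 - e) * h) else 0 := by
  induction w generalizing e with
  | zero =>
    rw [pow_zero, one_mul, (divByMonic_eq_zero_iff hf).2, coeff_zero, if_neg (by omega)]
    rwa [degree_eq_natDegree hf.ne_zero]
  | succ w ih =>
    rw [pow_succ', mul_assoc, X_mul_divByMonic hf hn, coeff_add]
    cases e with
    | zero => simp
    | succ e =>
      rw [coeff_X_mul, ih, coeff_C_succ, add_zero]
      simp only [Nat.add_lt_add_iff_right, Nat.add_sub_cancel]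
      rw [show w - 1 - e = w - (e + 1) by omega]

theorem divByMonic_sum (hf : f.Monic) {ι : Type*} (s : Finset ι) (p : ι → V[X]) :
    (∑ i ∈ s, p i) /ₘ f = ∑ i ∈ s, p i /ₘ f := by
  refine (div_modByMonic_unique _ (∑ i ∈ s, p i %ₘ f) hf ⟨?_, ?_⟩).1
  · rw [Finset.mul_sum, ← Finset.sum_add_distrib]
    exact Finset.sum_congr rfl fun i _ => modByMonic_add_div _ _
  · refine (degree_sum_le _ _).trans_lt ((Finset.sup_lt_iff ?_).2 fun i _ =>
      degree_modByMonic_lt _ hf)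
    exact bot_lt_iff_ne_bot.2 (degree_ne_bot.2 hf.ne_zero)

theorem C_mul_divByMonic (hf : f.Monic) (c : V) (p : V[X]) : (C c * p) /ₘ f = C c * (p /ₘ f) := by
  refine (div_modByMonic_unique _ (C c * (p %ₘ f)) hf ⟨?_, ?_⟩).1
  · conv_rhs => rw [← modByMonic_add_div p f]
    ring
  · rw [← smul_eq_C_mul]
    exact (degree_smul_le _ _).trans_lt (degree_modByMonic_lt _ hf)

theorem coeff_mul_divByMonic (hf : f.Monic) (hn : 0 < f.natDegree) {h g : V[X]}
    (hh : h.degree < f.natDegree) {δ : ℕ} (hg : g.degree < δ) (e : ℕ) :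
    ((g * h) /ₘ f).coeff e = ∑ w ∈ Finset.range δ,
      g.coeff w * if e < w then residueInf f (X ^ (w - 1 - e) * h) else 0 := by
  conv_lhs => rw [eq_sum_monomial_of_degree_lt hg, Finset.sum_mul, divByMonic_sum hf,
    finsetSum_coeff]
  refine Finset.sum_congr rfl fun w _ => ?_
  rw [← C_mul_X_pow_eq_monomial, mul_assoc, C_mul_divByMonic hf, coeff_C_mul,
    coeff_X_pow_mul_divByMonic hf hn hh]

/-- This is `f * (h / f) = h` in the variable `1 / X`. One inversion of the reversal of `f` thus
gives the expansion of any `h / f` by a product. -/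
theorem revSeries_mul_residueSeries (hf : f.Monic) (hn : 0 < f.natDegree) {h : V[X]}
    (hh : h.degree < f.natDegree) :
    revSeries (f.natDegree + 1) f.coeff * residueSeries f h = revSeries f.natDegree h.coeff := by
  ext i
  have h1 := congrArg (coeff · f.natDegree) (modByMonic_add_div (X ^ (i + 1) * h) f)
  have hd : ((X ^ (i + 1) * h) %ₘ f).degree < f.natDegree := by
    rw [← degree_eq_natDegree hf.ne_zero]
    exact degree_modByMonic_lt _ hf
  simp only [coeff_add, coeff_eq_zero_of_degree_lt hd, zero_add, coeff_X_pow_mul'] at h1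
  have h2 : PowerSeries.coeff i (revSeries f.natDegree h.coeff) =
      if i + 1 ≤ f.natDegree then h.coeff (f.natDegree - (i + 1)) else 0 := by
    rw [revSeries, PowerSeries.coeff_mk]
    by_cases h : i < f.natDegree
    · rw [if_pos h, if_pos (by omega), show f.natDegree - 1 - i = f.natDegree - (i + 1) by omega]
    · rw [if_neg h, if_neg (by omega)]
  rw [h2, ← h1, residueSeries, coeff_revSeries_mul, coeff_mul,
    Finset.Nat.sum_antidiagonal_eq_sum_range_succ_mk]
  refine Finset.sum_congr rfl fun u hu => ?_
  rw [Finset.mem_range] at hu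
  rw [coeff_X_pow_mul_divByMonic hf hn hh, Nat.add_sub_cancel]
  simp only [Nat.lt_succ_iff, Nat.add_sub_cancel]

/-- The lower part of the product, up to index `δ - 2`, is the quotient in reverse order. -/
theorem coeff_revSeries_mul_residueSeries_sub (hf : f.Monic) (hn : 0 < f.natDegree) {g h : V[X]}
    {δ : ℕ} (hg : g.degree < δ) (hh : h.degree < f.natDegree) {e : ℕ} (he : e + 2 ≤ δ) :
    PowerSeries.coeff (δ - 2 - e) (revSeries δ g.coeff * residueSeries f h) =
      ((g * h) /ₘ f).coeff e := by
  rw [residueSeries, coeff_revSeries_mul, coeff_mul_divByMonic hf hn hh hg]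
  refine Finset.sum_congr rfl fun w hw => ?_
  rw [Finset.mem_range] at hw
  congr 1
  by_cases h1 : e < w
  · rw [if_pos (by omega), if_pos h1, show δ - 2 - e - (δ - 1 - w) = w - 1 - e by omega]
  · rw [if_neg (by omega), if_neg h1]

theorem coeff_mul_divByMonic_eq_zero (hf : f.Monic) (hn : 0 < f.natDegree) {g h : V[X]}
    {δ : ℕ} (hg : g.degree < δ) (hh : h.degree < f.natDegree) {e : ℕ} (he : δ < e + 2) :
    ((g * h) /ₘ f).coeff e = 0 := by
  rw [coeff_mul_divByMonic hf hn hh hg]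
  refine Finset.sum_eq_zero fun w hw => ?_
  rw [Finset.mem_range] at hw
  rw [if_neg (by omega), mul_zero]

/-- The low coefficients of a quotient as middle products of blocks of length `m`. -/
theorem sum_coeff_blocks_mul_eq_coeff_divByMonic (hf : f.Monic) (hn : 0 < f.natDegree) {g h : V[X]}
    {δ : ℕ} (hg : g.degree < δ) (hh : h.degree < f.natDegree) {m T e : ℕ} (hT : δ ≤ m * T)
    (he : e < m) :
    ∑ β ∈ Finset.range T, PowerSeries.coeff (m - 1 + (m - 1 - e))
      (revSeries m (fun w => g.coeff (m * β + w)) * .mk fun s =>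
        if m ≤ m * β + s ∧ m * β + s - m < δ then residueInf f (X ^ (m * β + s - m) * h) else 0) =
      ((g * h) /ₘ f).coeff e := by
  rw [coeff_mul_divByMonic hf hn hh (δ := m * T) (hg.trans_le (by exact_mod_cast hT)),
    Finset.sum_range_mul_eq_sum_sum, Finset.sum_comm]
  rw [Finset.sum_comm]
  rw [Finset.sum_comm (s := Finset.range m)]
  refine Finset.sum_congr rfl fun β _ => ?_
  rw [coeff_revSeries_mul_add]
  refine Finset.sum_congr rfl fun w hw => ?_
  rw [Finset.mem_range] at hw
  rcases lt_or_ge (m * β + w) δ with h1 | h1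
  · congr 1
    by_cases h2 : e < m * β + w
    · rw [if_pos (by omega), if_pos h2,
        show m * β + (w + (m - 1 - e)) - m = m * β + w - 1 - e by omega]
    · rw [if_neg (by omega), if_neg h2]
  · rw [coeff_eq_zero_of_degree_lt (hg.trans_le (by exact_mod_cast h1)), zero_mul, zero_mul]

end Residues

/-! ### Computations modulo a monic polynomial -/

section Modular

/-- Operations with power series over a `K`-algebra truncated at order `N ≤ M` cost at most
`N * τ`. -/
def SeriesOpBound (K : Type*) [Field K] (M τ : ℕ) : Prop :=
  ∀ N ≤ M, ∀ (V : Type u) [CommRing V] [Algebra K V], SeriesOpCost K V N (N * τ)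

variable {K : Type*} [Field K] {V : Type u} [CommRing V] [Algebra K V] {M τ N : ℕ}
  {S : Known K V}

theorem SeriesOpBound.mul (h : SeriesOpBound.{u} K M τ) (hN : N ≤ M) {p q : PowerSeries V}
    (hp : ∀ i < N, PowerSeries.coeff i p ∈ S) (hq : ∀ i < N, PowerSeries.coeff i q ∈ S) :
    S.Yields (N * τ) {x | ∃ i < N, PowerSeries.coeff i (p * q) = x} :=
  h N hN V S .mul p q _ rfl hp hq

theorem SeriesOpBound.matMul (h : SeriesOpBound.{u} K M τ) (hN : N ≤ M) {s c : ℕ}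
    (hc : MatMulCost K (PowerSeries V) s c) {P Q : ℕ → ℕ → PowerSeries V}
    (hP : ∀ i < s, ∀ j < s, ∀ e < N, PowerSeries.coeff e (P i j) ∈ S)
    (hQ : ∀ i < s, ∀ j < s, ∀ e < N, PowerSeries.coeff e (Q i j) ∈ S) :
    S.Yields (c * (N * τ)) {x | ∃ i < s, ∃ j < s, ∃ e < N,
      ∑ k ∈ Finset.range s, PowerSeries.coeff e (P i k * Q k j) = x} := by
  have h1 := hc (Known.ofSet {x | ∃ i < s, ∃ j < s, x = P i j ∨ x = Q i j}) P Q
    (fun i hi j hj => Or.inr ⟨i, hi, j, hj, Or.inl rfl⟩)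
    (fun i hi j hj => Or.inr ⟨i, hi, j, hj, Or.inr rfl⟩)
  refine (h1.truncate (h N hN V) (S₀ := S) fun x hx => Known.coeff_mem_of_mem_ofSet ?_
    hx).mono_right ?_
  · rintro x ⟨i, hi, j, hj, rfl | rfl⟩
    exacts [hP i hi j hj, hQ i hi j hj]
  · rintro _ ⟨i, hi, j, hj, e, he, rfl⟩
    exact ⟨_, ⟨i, hi, j, hj, rfl⟩, e, he, map_sum _ _ _⟩

variable {f : V[X]}

theorem SeriesOpBound.coeff_modByMonic (h : SeriesOpBound.{u} K M τ) (hN : N ≤ M)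
    (hfS : ∀ i, f.coeff i ∈ S) {p : V[X]} (hp : ∀ i < N, p.coeff i ∈ S)
    (hq : ∀ i < N, (p /ₘ f).coeff i ∈ S) :
    S.Yields (2 * (N * τ)) {x | ∃ i < N, (p %ₘ f).coeff i = x} := by
  refine ((h.mul hN (p := (f : PowerSeries V)) (q := ((p /ₘ f : V[X]) : PowerSeries V))
    (fun i _ => by simpa using hfS i) (fun i hi => by simpa using hq i hi)).bind (n' := N * τ)
      fun S₁ hS₁ hT₁ => ?_).mono_cost (by omega)
  refine (h N hN V S₁ .sub (p : PowerSeries V) _ _ rfl (fun i hi => by simpa using hS₁ (hp i hi))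
    fun i hi => hT₁ _ ⟨i, hi, rfl⟩).mono_right ?_
  rintro _ ⟨i, hi, rfl⟩
  refine ⟨i, hi, ?_⟩
  rw [modByMonic_eq_sub_mul_div, map_sub, ← Polynomial.coe_mul, Polynomial.coeff_coe,
    Polynomial.coeff_coe, coeff_sub]

theorem SeriesOpBound.residues [Nontrivial V] (h : SeriesOpBound.{u} K M τ) (hN : N ≤ M)
    (hf : f.Monic) (hn : 0 < f.natDegree) {w : PowerSeries V}
    (hw : revSeries (f.natDegree + 1) f.coeff * w = 1) (hwS : ∀ i < N, PowerSeries.coeff i w ∈ S)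
    {p : V[X]} (hp : p.degree < f.natDegree) (hpS : ∀ i, p.coeff i ∈ S) :
    S.Yields (N * τ) {x | ∃ i < N, residueInf f (X ^ i * p) = x} := by
  have e : residueSeries f p = w * revSeries f.natDegree p.coeff := by
    rw [← revSeries_mul_residueSeries hf hn hp, ← mul_assoc, mul_comm w, hw, one_mul]
  refine (h.mul hN hwS (q := revSeries f.natDegree p.coeff) fun i _ => ?_).mono_right ?_
  · rw [revSeries, PowerSeries.coeff_mk]
    split_ifs
    exacts [hpS _, S.zero_mem]
  · rintro _ ⟨i, hi, rfl⟩
    refine ⟨i, hi, ?_⟩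
    rw [← e, residueSeries, PowerSeries.coeff_mk]

theorem Known.coeff_revSeries_mem {s : ℕ} {p : ℕ → V} (hp : ∀ i < s, p i ∈ S) (i : ℕ) :
    PowerSeries.coeff i (revSeries s p) ∈ S := by
  rw [revSeries, PowerSeries.coeff_mk]
  split_ifs
  exacts [hp _ (by omega), S.zero_mem]

theorem Polynomial.degree_modByMonic_lt_natDegree [Nontrivial V] (hf : f.Monic) (p : V[X]) :
    (p %ₘ f).degree < f.natDegree := by
  rw [← degree_eq_natDegree hf.ne_zero]
  exact degree_modByMonic_lt p hf

/-- Multiplication modulo `f`. -/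
theorem SeriesOpBound.mul_modByMonic [Nontrivial V] (h : SeriesOpBound.{u} K M τ)
    (hM : f.natDegree ≤ M) (hf : f.Monic) (hn : 0 < f.natDegree) (hfS : ∀ i, f.coeff i ∈ S)
    {w : PowerSeries V} (hw : revSeries (f.natDegree + 1) f.coeff * w = 1)
    (hwS : ∀ i < f.natDegree, PowerSeries.coeff i w ∈ S)
    {p q : V[X]} (hp : p.degree < f.natDegree) (hpS : ∀ i, p.coeff i ∈ S)
    (hq : q.degree < f.natDegree) (hqS : ∀ i, q.coeff i ∈ S) :
    S.Yields (5 * (f.natDegree * τ)) {x | ∃ i, ((p * q) %ₘ f).coeff i = x} := by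
  refine ((h.residues hM hf hn hw hwS hq hqS).bind (n' := f.natDegree * τ + (f.natDegree * τ +
    2 * (f.natDegree * τ))) fun S₁ hS₁ hT₁ => ?_).mono_cost (by omega)
  refine (h.mul hM (p := revSeries f.natDegree p.coeff) (q := residueSeries f q)
    (fun i _ => Known.coeff_revSeries_mem (fun i _ => hS₁ (hpS i)) i) (fun i hi => by
      rw [residueSeries, PowerSeries.coeff_mk]
      exact hT₁ _ ⟨i, hi, rfl⟩)).bind fun S₂ hS₂ hT₂ => ?_
  refine (h.mul hM (p := (p : PowerSeries V)) (q := (q : PowerSeries V))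
    (fun i _ => by simpa using hS₂ (hS₁ (hpS i)))
    (fun i _ => by simpa using hS₂ (hS₁ (hqS i)))).bind fun S₃ hS₃ hT₃ => ?_
  refine (h.coeff_modByMonic hM (fun i => hS₃ (hS₂ (hS₁ (hfS i)))) (p := p * q) (fun i hi => ?_)
    fun i hi => ?_).mono_right_or ?_
  · refine hT₃ _ ⟨i, hi, ?_⟩
    rw [← Polynomial.coe_mul, Polynomial.coeff_coe]
  · rcases Nat.lt_or_ge f.natDegree (i + 2) with h1 | h1
    · rw [coeff_mul_divByMonic_eq_zero hf hn hp hq h1]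
      exact S₃.zero_mem
    · exact hS₃ (hT₂ _ ⟨f.natDegree - 2 - i, by omega,
        coeff_revSeries_mul_residueSeries_sub hf hn hp hq h1⟩)
  · rintro _ ⟨i, rfl⟩
    rcases lt_or_ge i f.natDegree with hi | hi
    · exact Or.inl ⟨i, hi, rfl⟩
    · rw [coeff_eq_zero_of_degree_lt
        ((degree_modByMonic_lt_natDegree hf _).trans_le (by exact_mod_cast hi))]
      exact Or.inr S₃.zero_mem

/-- The first powers of `a` modulo `f`, multiplied by `b`. -/
theorem SeriesOpBound.powers_modByMonic [Nontrivial V] (h : SeriesOpBound.{u} K M τ)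
    (hM : f.natDegree ≤ M) (hf : f.Monic) (hn : 0 < f.natDegree) (hfS : ∀ i, f.coeff i ∈ S)
    {w : PowerSeries V} (hw : revSeries (f.natDegree + 1) f.coeff * w = 1)
    (hwS : ∀ i < f.natDegree, PowerSeries.coeff i w ∈ S)
    {a b : V[X]} (ha : a.degree < f.natDegree) (haS : ∀ i, a.coeff i ∈ S)
    (hb : b.degree < f.natDegree) (hbS : ∀ i, b.coeff i ∈ S) (T : ℕ) :
    S.Yields (T * (5 * (f.natDegree * τ)))
      {x | ∃ t < T, ∃ i, ((b * a ^ t) %ₘ f).coeff i = x} := by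
  refine Known.Yields.iterate T (T := fun t => {x | ∃ i, ((b * a ^ t) %ₘ f).coeff i = x})
    fun t _ S₁ hS₁ hT₁ => ?_
  cases t with
  | zero =>
    refine .done ?_
    rintro _ ⟨i, rfl⟩
    rw [pow_zero, mul_one, (modByMonic_eq_self_iff hf).2 (by rwa [degree_eq_natDegree hf.ne_zero])]
    exact hS₁ (hbS i)
  | succ t =>
    have e : (b * a ^ (t + 1)) %ₘ f = (a * ((b * a ^ t) %ₘ f)) %ₘ f := by
      refine modByMonic_eq_of_dvd_sub hf ?_
      have h1 := (dvd_modByMonic_sub (b * a ^ t) f).mul_left (-a)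
      have h2 : b * a ^ (t + 1) - a * ((b * a ^ t) %ₘ f) =
        -a * ((b * a ^ t) %ₘ f - b * a ^ t) := by ring
      rwa [h2]
    rw [e]
    exact h.mul_modByMonic hM hf hn (fun i => hS₁ (hfS i)) hw (fun i hi => hS₁ (hwS i hi)) ha
      (fun i => hS₁ (haS i)) (degree_modByMonic_lt_natDegree hf _)
      fun i => hT₁ t (Nat.lt_succ_self t) _ ⟨i, rfl⟩

/-- Linear combinations modulo `f` with coefficients of degree less than `δ`: from the first
coefficients and the expansions at infinity to the first coefficients and the expansions at
infinity. -/
theorem SeriesOpBound.linearCombination [Nontrivial V] (h : SeriesOpBound.{u} K M τ)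
    (hf : f.Monic) (hn : 0 < f.natDegree) (hfS : ∀ i, f.coeff i ∈ S) {s c m δ : ℕ}
    (hc : MatMulCost K (PowerSeries V) s c) (hm : m ≤ M) (hδ : 2 * δ ≤ M)
    {g H : ℕ → ℕ → V[X]} (hg : ∀ j < s, ∀ u < s, (g j u).degree < δ)
    (hgS : ∀ j < s, ∀ u < s, ∀ i, (g j u).coeff i ∈ S)
    (hH : ∀ u < s, ∀ l < s, (H u l).degree < f.natDegree)
    (hHS : ∀ u < s, ∀ l < s, ∀ i < m, (H u l).coeff i ∈ S)
    (hHS' : ∀ u < s, ∀ l < s, ∀ i < 2 * δ, residueInf f (X ^ i * H u l) ∈ S) :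
    S.Yields (c * (2 * δ * τ) + (c * (m * τ) + s * (s * (2 * (m * τ)))))
      {x | ∃ j < s, ∃ l < s,
        (∃ i < m, ((∑ u ∈ Finset.range s, g j u * H u l) %ₘ f).coeff i = x) ∨
        ∃ i < δ, residueInf f (X ^ i * ((∑ u ∈ Finset.range s, g j u * H u l) %ₘ f)) = x} := by
  -- A single product at precision `2 * δ` yields the quotients (indices up to `δ - 2`) and the new
  -- residues (indices from `δ - 1`).
  refine (h.matMul hδ hc (P := fun j u => revSeries δ (g j u).coeff)
    (Q := fun u l => residueSeries f (H u l))
    (fun j hj u hu e _ => Known.coeff_revSeries_mem (fun i _ => hgS j hj u hu i) e)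
    (fun u hu l hl e he => by
      rw [residueSeries, PowerSeries.coeff_mk]
      exact hHS' u hu l hl e he)).bind fun S₁ hS₁ hT₁ => ?_
  refine (h.matMul hm hc (P := fun j u => (g j u : PowerSeries V))
    (Q := fun u l => (H u l : PowerSeries V))
    (fun j hj u hu e _ => by simpa using hS₁ (hgS j hj u hu e))
    (fun u hu l hl e he => by simpa using hS₁ (hHS u hu l hl e he))).bind fun S₂ hS₂ hT₂ => ?_
  refine (Known.Yields.range s (T := fun j => {x | ∃ l < s, ∃ i < m,
      ((∑ u ∈ Finset.range s, g j u * H u l) %ₘ f).coeff i = x}) fun j hj =>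
    (Known.Yields.range s (T := fun l => {x | ∃ i < m,
      ((∑ u ∈ Finset.range s, g j u * H u l) %ₘ f).coeff i = x}) fun l hl => ?_).mono_right
        ?_).mono_right_or ?_
  · refine h.coeff_modByMonic hm (fun i => hS₂ (hS₁ (hfS i))) (fun i hi => ?_) fun i hi => ?_
    · refine hT₂ _ ⟨j, hj, l, hl, i, hi, ?_⟩
      rw [finsetSum_coeff]
      exact Finset.sum_congr rfl fun u _ => by rw [← Polynomial.coe_mul, Polynomial.coeff_coe]
    · rw [divByMonic_sum hf, finsetSum_coeff]
      rcases Nat.lt_or_ge δ (i + 2) with h1 | h1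
      · rw [Finset.sum_eq_zero fun u hu => coeff_mul_divByMonic_eq_zero hf hn
          (hg j hj u (Finset.mem_range.1 hu)) (hH u (Finset.mem_range.1 hu) l hl) h1]
        exact S₂.zero_mem
      · exact hS₂ (hT₁ _ ⟨j, hj, l, hl, δ - 2 - i, by omega, Finset.sum_congr rfl fun u hu =>
          coeff_revSeries_mul_residueSeries_sub hf hn (hg j hj u (Finset.mem_range.1 hu))
            (hH u (Finset.mem_range.1 hu) l hl) h1⟩)
  · rintro _ ⟨l, hl, i, hi, rfl⟩
    exact ⟨l, hl, i, hi, rfl⟩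
  · rintro x ⟨j, hj, l, hl, ⟨i, hi, rfl⟩ | ⟨i, hi, rfl⟩⟩
    · exact Or.inl ⟨j, hj, l, hl, i, hi, rfl⟩
    · refine Or.inr (hS₂ (hT₁ _ ⟨j, hj, l, hl, δ - 1 + i, by omega, ?_⟩))
      rw [residueInf_mul_modByMonic hf, Finset.mul_sum, map_sum]
      exact Finset.sum_congr rfl fun u hu =>
        coeff_revSeries_mul_residueSeries_add (hg j hj u (Finset.mem_range.1 hu)) i

end Modular

/-! ### Low coefficients of all the powers -/

section TruncatedPowers

variable {K : Type*} [Field K] {V : Type u} [CommRing V] [Algebra K V] {M τ : ℕ}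
  {S : Known K V} {f : V[X]}

/-- The low coefficients of the quotients by `f` of `s ^ 3` linear combinations, by products of
matrices of bivariate power series. -/
theorem SeriesOpBound.quotients [Nontrivial V] (h : SeriesOpBound.{u} K M τ)
    (hf : f.Monic) (hn : 0 < f.natDegree) {s c m δ D : ℕ}
    (hc : MatMulCost K (PowerSeries (PowerSeries V)) s c) (hm : 2 * m ≤ M) (hs : 2 * s ≤ M)
    (hD : δ ≤ m * (s * D))
    {g E : ℕ → ℕ → V[X]} (hg : ∀ j < s, ∀ u < s, (g j u).degree < δ)
    (hgS : ∀ j < s, ∀ u < s, ∀ i, (g j u).coeff i ∈ S)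
    (hE : ∀ l < s, ∀ t < 2 * s, (E l t).degree < f.natDegree)
    (hES : ∀ l < s, ∀ t < 2 * s, ∀ i < δ, residueInf f (X ^ i * E l t) ∈ S) :
    S.Yields (D * (c + s * s) * (2 * s * τ) * (2 * m * τ))
      {x | ∃ j < s, ∃ l < s, ∃ i < s, ∃ e < m,
        ((∑ u ∈ Finset.range s, g j u * E l (u + i)) /ₘ f).coeff e = x} := by
  -- The outer variable records `u` and `t`, the inner one positions inside the block `β`. Reversing
  -- the factors from `g` turns sums of the form `∑ u, g u * E (u + i)` into coefficients of
  -- products.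
  set P : ℕ → ℕ → PowerSeries (PowerSeries V) := fun j β =>
    revSeries s fun u => revSeries m fun w => (g j u).coeff (m * β + w) with hP
  set Q : ℕ → ℕ → PowerSeries (PowerSeries V) := fun β l => .mk fun t => .mk fun k =>
    if m ≤ m * β + k ∧ m * β + k - m < δ then residueInf f (X ^ (m * β + k - m) * E l t) else 0
    with hQ
  have h1 := hc.blocks D (S := Known.ofSet {x | ∃ i < s, ∃ β, x = P i β ∨ x = Q β i})
    (P := P) (Q := Q) (fun i hi β _ => Or.inr ⟨i, hi, β, Or.inl rfl⟩)
    (fun β _ l hl => Or.inr ⟨l, hl, β, Or.inr rfl⟩)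
  -- Truncation in the outer variable, then in the inner one: each costs a factor `τ`, which is
  -- where `τ * τ` comes from.
  have h2 := h1.truncate (h (2 * s) hs (PowerSeries V))
    (S₀ := Known.ofSet {x | ∃ i < s, ∃ β, ∃ t < 2 * s,
      x = PowerSeries.coeff t (P i β) ∨ x = PowerSeries.coeff t (Q β i)}) fun x hx =>
      Known.coeff_mem_of_mem_ofSet (by
        rintro x ⟨i, hi, β, rfl | rfl⟩ t ht
        exacts [Or.inr ⟨i, hi, β, t, ht, Or.inl rfl⟩, Or.inr ⟨i, hi, β, t, ht, Or.inr rfl⟩]) hx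
  have h3 := h2.truncate (h (2 * m) hm V) (S₀ := S) fun x hx =>
      Known.coeff_mem_of_mem_ofSet (by
        rintro x ⟨i, hi, β, t, ht, rfl | rfl⟩ k hk
        · simp only [hP]
          rw [revSeries, PowerSeries.coeff_mk]
          split_ifs
          · exact Known.coeff_revSeries_mem (fun w _ => hgS i hi _ (by omega) _) k
          · rw [map_zero]
            exact S.zero_mem
        · simp only [hQ]
          rw [PowerSeries.coeff_mk, PowerSeries.coeff_mk]
          split_ifs with h0
          exacts [hES i hi t ht _ h0.2, S.zero_mem]) hx
  refine h3.mono_right ?_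
  rintro _ ⟨j, hj, l, hl, i, hi, e, he, rfl⟩
  refine ⟨_, ⟨_, ⟨j, hj, l, hl, rfl⟩, s - 1 + i, by omega, rfl⟩, m - 1 + (m - 1 - e), by omega, ?_⟩
  rw [map_sum, map_sum, divByMonic_sum hf, finsetSum_coeff]
  simp only [hP, hQ, coeff_revSeries_mul_add, map_sum]
  rw [Finset.sum_comm]
  refine Finset.sum_congr rfl fun u hu => ?_
  rw [Finset.mem_range] at hu
  have key := sum_coeff_blocks_mul_eq_coeff_divByMonic hf hn (hg j hj u hu)
    (hE l hl (u + i) (by omega)) hD he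
  simp only [coeff_revSeries_mul_add] at key
  exact key

/-- With the quotients at hand, `s` matrix products of precision only `m` give the low coefficients
before reduction. No residues of the results are needed. -/
theorem SeriesOpBound.truncatedCombinations [Nontrivial V] (h : SeriesOpBound.{u} K M τ)
    (hf : f.Monic) (hn : 0 < f.natDegree) (hfS : ∀ i, f.coeff i ∈ S) {s c m δ D : ℕ}
    (hc : ∀ (V : Type u) [CommRing V] [Algebra K V], MatMulCost K V s c)
    (hm : 2 * m ≤ M) (hs : 2 * s ≤ M) (hD : δ ≤ m * (s * D))
    {g E : ℕ → ℕ → V[X]} (hg : ∀ j < s, ∀ u < s, (g j u).degree < δ)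
    (hgS : ∀ j < s, ∀ u < s, ∀ i, (g j u).coeff i ∈ S)
    (hE : ∀ l < s, ∀ t < 2 * s, (E l t).degree < f.natDegree)
    (hES : ∀ l < s, ∀ t < 2 * s, ∀ i < m, (E l t).coeff i ∈ S)
    (hES' : ∀ l < s, ∀ t < 2 * s, ∀ i < δ, residueInf f (X ^ i * E l t) ∈ S) :
    S.Yields (D * (c + s * s) * (2 * s * τ) * (2 * m * τ) + (s * (c * (m * τ)) +
        s * (s * (s * (2 * (m * τ))))))
      {x | ∃ j < s, ∃ l < s, ∃ i < s, ∃ e < m,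
        ((∑ u ∈ Finset.range s, g j u * E l (u + i)) %ₘ f).coeff e = x} := by
  refine (h.quotients hf hn (hc _) hm hs hD hg hgS hE hES').bind fun S₁ hS₁ hT₁ => ?_
  refine (Known.Yields.range s (T := fun l => _) fun l hl =>
    h.matMul (S := S₁) (N := m) (by omega) (hc _) (P := fun j u => (g j u : PowerSeries V))
      (Q := fun u i => (E l (u + i) : PowerSeries V))
      (fun j hj u hu e _ => by simpa using hS₁ (hgS j hj u hu e))
      (fun u hu i hi e he => by simpa using hS₁ (hES l hl _ (by omega) e he))).bind
        fun S₂ hS₂ hT₂ => ?_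
  refine (Known.Yields.range s (T := fun j => {x | ∃ l < s, ∃ i < s, ∃ e < m,
      ((∑ u ∈ Finset.range s, g j u * E l (u + i)) %ₘ f).coeff e = x}) fun j hj =>
    (Known.Yields.range s (T := fun l => {x | ∃ i < s, ∃ e < m,
      ((∑ u ∈ Finset.range s, g j u * E l (u + i)) %ₘ f).coeff e = x}) fun l hl =>
    (Known.Yields.range s (T := fun i => {x | ∃ e < m,
      ((∑ u ∈ Finset.range s, g j u * E l (u + i)) %ₘ f).coeff e = x}) fun i hi => ?_).mono_right
        ?_).mono_right ?_).mono_right ?_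
  · refine h.coeff_modByMonic (by omega) (fun i => hS₂ (hS₁ (hfS i))) (fun e he => ?_)
      fun e he => ?_
    · refine hT₂ _ ⟨l, hl, j, hj, i, hi, e, he, ?_⟩
      rw [finsetSum_coeff]
      exact Finset.sum_congr rfl fun u _ => by rw [← Polynomial.coe_mul, Polynomial.coeff_coe]
    · exact hS₂ (hT₁ _ ⟨j, hj, l, hl, i, hi, e, he, rfl⟩)
  · rintro _ ⟨i, hi, e, he, rfl⟩
    exact ⟨i, hi, e, he, rfl⟩
  · rintro _ ⟨l, hl, i, hi, e, he, rfl⟩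
    exact ⟨l, hl, i, hi, e, he, rfl⟩
  · rintro _ ⟨j, hj, l, hl, i, hi, e, he, rfl⟩
    exact ⟨j, hj, l, hl, i, hi, e, he, rfl⟩

theorem AdjoinRoot.mk_modByMonic (p : V[X]) :
    AdjoinRoot.mk f (p %ₘ f) = AdjoinRoot.mk f p :=
  AdjoinRoot.mk_eq_mk.2 (dvd_modByMonic_sub p f)

/-- Powers with exponents written in base `s`, as iterated linear combinations modulo `f`. -/
theorem mul_pow_modByMonic_eq (hf : f.Monic) {s i j l : ℕ} {a b : V[X]} {A B : ℕ → V[X]}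
    (hA : f ∣ ∑ u ∈ Finset.range s, A u * a ^ u - a ^ (j * s))
    (hB : f ∣ ∑ v ∈ Finset.range s, B v * a ^ v - a ^ (l * s ^ 2)) :
    (b * a ^ (i + j * s + l * s ^ 2)) %ₘ f =
      (∑ u ∈ Finset.range s, A u *
        ((∑ v ∈ Finset.range s, B v * ((b * a ^ (v + (u + i))) %ₘ f)) %ₘ f)) %ₘ f := by
  refine modByMonic_eq_of_dvd_sub hf (AdjoinRoot.mk_eq_mk.1 ?_)
  have hA' := AdjoinRoot.mk_eq_mk.2 hA
  have hB' := AdjoinRoot.mk_eq_mk.2 hB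
  simp only [map_sum, map_mul, map_pow, AdjoinRoot.mk_modByMonic] at hA' hB' ⊢
  rw [pow_add, pow_add, ← hA', ← hB', mul_assoc, Finset.sum_mul_sum, Finset.mul_sum, Finset.mul_sum]
  refine Finset.sum_congr rfl fun u _ => ?_
  rw [Finset.mul_sum, Finset.mul_sum, Finset.mul_sum]
  refine Finset.sum_congr rfl fun v _ => ?_
  ring

theorem truncatedPowers_cost_le {s c m δ n D τ : ℕ} (hs : 0 < s) (hsc : s * s ≤ c)
    (hnδ : n ≤ s * δ) (hD : m * (s * D) ≤ δ + m * s) :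
    2 * n * τ + (3 * s * (5 * (n * τ)) + (3 * s * (2 * δ * τ) +
      ((c * (2 * δ * τ) + (c * (m * τ) + s * (s * (2 * (m * τ))))) +
      ((c * (2 * δ * τ) + (c * (m * τ) + s * (s * (2 * (m * τ))))) +
      (D * (c + s * s) * (2 * s * τ) * (2 * m * τ) + (s * (c * (m * τ)) +
        s * (s * (s * (2 * (m * τ)))))))))) ≤ 35 * (c * (δ + m * s) * (τ * τ)) := by
  have hc1 : s ≤ c := (Nat.le_mul_self s).trans hsc
  have hττ : τ ≤ τ * τ := Nat.le_mul_self τ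
  have hms : m ≤ m * s := Nat.le_mul_of_pos_right m hs
  have h2 : s * (n * τ) ≤ c * δ * (τ * τ) :=
    calc s * (n * τ) ≤ s * (s * δ * (τ * τ)) := by gcongr
      _ = s * s * δ * (τ * τ) := by ring
      _ ≤ _ := by gcongr
  have h1 : n * τ ≤ c * δ * (τ * τ) := (Nat.le_mul_of_pos_left _ hs).trans h2
  have h4 : c * (δ * τ) ≤ c * δ * (τ * τ) := by rw [mul_assoc]; gcongr
  have h3 : s * (δ * τ) ≤ c * δ * (τ * τ) := le_trans (by gcongr) h4
  have h5 : c * (m * τ) ≤ c * (m * s) * (τ * τ) := by rw [mul_assoc]; gcongr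
  have h6 : s * (s * (m * τ)) ≤ c * (m * s) * (τ * τ) :=
    le_trans (by rw [← mul_assoc]; gcongr) h5
  have h8 : s * (c * (m * τ)) ≤ c * (m * s) * (τ * τ) :=
    calc s * (c * (m * τ)) = c * (m * s) * τ := by ring
      _ ≤ _ := by gcongr
  have h9 : s * (s * (s * (m * τ))) ≤ c * (m * s) * (τ * τ) :=
    calc s * (s * (s * (m * τ))) = s * (s * s * (m * τ)) := by ring
      _ ≤ s * (c * (m * τ)) := by gcongr
      _ ≤ _ := h8
  have h7 : D * (c + s * s) * (2 * s * τ) * (2 * m * τ) ≤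
      8 * (c * δ * (τ * τ)) + 8 * (c * (m * s) * (τ * τ)) :=
    calc D * (c + s * s) * (2 * s * τ) * (2 * m * τ)
        = 4 * ((c + s * s) * (m * (s * D)) * (τ * τ)) := by ring
      _ ≤ 4 * ((c + c) * (δ + m * s) * (τ * τ)) := by gcongr
      _ = _ := by ring
  calc _ = 2 * (n * τ) + 15 * (s * (n * τ)) + 6 * (s * (δ * τ)) + 4 * (c * (δ * τ)) +
        2 * (c * (m * τ)) + 4 * (s * (s * (m * τ))) +
        D * (c + s * s) * (2 * s * τ) * (2 * m * τ) + s * (c * (m * τ)) +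
        2 * (s * (s * (s * (m * τ)))) := by ring
    _ ≤ 35 * (c * δ * (τ * τ)) + 35 * (c * (m * s) * (τ * τ)) := by
      linarith [Nat.zero_le (c * (m * s) * (τ * τ))]
    _ = _ := by ring

/-- Truncated powers modulo a monic polynomial. -/
theorem SeriesOpBound.truncatedPowers [Nontrivial V] {s c m δ n : ℕ}
    (h : SeriesOpBound.{u} K (4 * n) τ)
    (hf : f.Monic) (hfn : f.natDegree = n) (hfS : ∀ i, f.coeff i ∈ S)
    (hc : ∀ (V : Type u) [CommRing V] [Algebra K V], MatMulCost K V s c) (hsc : s * s ≤ c)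
    (hs : 0 < s) (hsn : s ≤ n) (hm : 0 < m) (hmn : m ≤ n) (hδ : δ ≤ n) (hnδ : n ≤ s * δ)
    {a b : V[X]} (ha : a.degree < n) (haS : ∀ i, a.coeff i ∈ S)
    (hb : b.degree < n) (hbS : ∀ i, b.coeff i ∈ S)
    {A B : ℕ → ℕ → V[X]} (hA : ∀ j < s, ∀ u < s, (A j u).degree < δ)
    (hAS : ∀ j < s, ∀ u < s, ∀ i, (A j u).coeff i ∈ S)
    (hB : ∀ l < s, ∀ v < s, (B l v).degree < δ)
    (hBS : ∀ l < s, ∀ v < s, ∀ i, (B l v).coeff i ∈ S)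
    (hA' : ∀ j < s, f ∣ ∑ u ∈ Finset.range s, A j u * a ^ u - a ^ (j * s))
    (hB' : ∀ l < s, f ∣ ∑ v ∈ Finset.range s, B l v * a ^ v - a ^ (l * s ^ 2)) :
    S.Yields (35 * (c * (δ + m * s) * (τ * τ)))
      {x | ∃ k < s ^ 3, ∃ e < m, ((b * a ^ k) %ₘ f).coeff e = x} := by
  have hn : 0 < f.natDegree := by omega
  obtain ⟨w, hw⟩ : ∃ w, revSeries (f.natDegree + 1) f.coeff * w = 1 := by
    refine IsUnit.exists_right_inv (PowerSeries.isUnit_iff_constantCoeff.2 ?_)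
    rw [← PowerSeries.coeff_zero_eq_constantCoeff_apply, revSeries, PowerSeries.coeff_mk,
      if_pos (by omega)]
    have : f.coeff (f.natDegree + 1 - 1 - 0) = 1 := hf
    rw [this]
    exact isUnit_one
  have hwinv : Ring.inverse (revSeries (f.natDegree + 1) f.coeff) = w := by
    rw [← Ring.inverse_mul_cancel_left _ w (IsUnit.of_mul_eq_one _ hw), hw, mul_one]
  set E : ℕ → ℕ → V[X] := fun l t =>
    (∑ v ∈ Finset.range s, B l v * ((b * a ^ (v + t)) %ₘ f)) %ₘ f with hE
  -- `s * D` blocks of length `m` cover `δ` with waste at most `m * s`.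
  set D := δ / (m * s) + 1 with hD
  have hms : 0 < m * s := Nat.mul_pos hm hs
  have hDδ : δ ≤ m * (s * D) := by
    rw [← mul_assoc, hD, mul_add, mul_one]
    have h1 := Nat.div_add_mod δ (m * s)
    have h2 := Nat.mod_lt δ hms
    omega
  have hDδ' : m * (s * D) ≤ δ + m * s := by
    rw [← mul_assoc, hD, mul_add, mul_one]
    have h1 := Nat.div_mul_le_self δ (m * s)
    rw [mul_comm] at h1
    omega
  -- The `2 * s` values of `t` needed in `E l t` are split into two square products, with `ε = 0`
  -- and `ε = s`.
  have hcomb : ∀ ε, ∀ S' : Known K V, S ≤ S' → ε + s ≤ 2 * s →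
      (∀ t < 3 * s, ∀ i, ((b * a ^ t) %ₘ f).coeff i ∈ S') →
      (∀ t < 3 * s, ∀ i < 2 * δ, residueInf f (X ^ i * ((b * a ^ t) %ₘ f)) ∈ S') →
      S'.Yields (c * (2 * δ * τ) + (c * (m * τ) + s * (s * (2 * (m * τ)))))
        {x | ∃ l < s, ∃ t < s, (∃ i < m, (E l (t + ε)).coeff i = x) ∨
          ∃ i < δ, residueInf f (X ^ i * E l (t + ε)) = x} := by
    intro ε S' hS' hε h1 h2
    exact h.linearCombination hf hn (fun i => hS' (hfS i)) (hc _) (by omega) (by omega)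
      (g := B) (H := fun v t => (b * a ^ (v + (t + ε))) %ₘ f) hB
      (fun j hj u hu i => hS' (hBS j hj u hu i))
      (fun u _ l _ => degree_modByMonic_lt_natDegree hf _)
      (fun u hu l hl i _ => h1 _ (by omega) i) (fun u hu l hl i hi => h2 _ (by omega) i hi)
  refine Known.Yields.mono_cost (n := 2 * n * τ + (3 * s * (5 * (n * τ)) + (3 * s * (2 * δ * τ) +
    ((c * (2 * δ * τ) + (c * (m * τ) + s * (s * (2 * (m * τ))))) +
    ((c * (2 * δ * τ) + (c * (m * τ) + s * (s * (2 * (m * τ))))) +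
    (D * (c + s * s) * (2 * s * τ) * (2 * m * τ) + (s * (c * (m * τ)) +
        s * (s * (s * (2 * (m * τ))))))))))) ?_ ?_
  -- Precision `2 * n` suffices because at most `2 * δ ≤ 2 * n` residues are extracted.
  · refine (h (2 * n) (by omega) V S .div 1 (revSeries (f.natDegree + 1) f.coeff) w (by
      rw [← hwinv]
      simp [ArithOp.apply, IsUnit.of_mul_eq_one _ hw]) (fun i _ => by
        rw [PowerSeries.coeff_one]
        split_ifs
        exacts [S.one_mem, S.zero_mem])
        fun i _ => Known.coeff_revSeries_mem (fun i _ => hfS i) i).bind fun S₁ hS₁ hT₁ => ?_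
    rw [← hfn] at ha hb
    have hp := h.powers_modByMonic (by omega) hf hn (fun i => hS₁ (hfS i)) hw
      (fun i hi => hT₁ _ ⟨i, by omega, rfl⟩) ha (fun i => hS₁ (haS i)) hb (fun i => hS₁ (hbS i))
      (3 * s)
    rw [hfn] at hp
    refine hp.bind fun S₂ hS₂ hT₂ => ?_
    refine (Known.Yields.range (3 * s) (T := fun t => _) fun t ht =>
      h.residues (N := 2 * δ) (by omega) hf hn hw (fun i hi => hS₂ (hT₁ _ ⟨i, by omega, rfl⟩))
        (degree_modByMonic_lt_natDegree hf _) fun i => hT₂ _ ⟨t, ht, i, rfl⟩).bind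
          fun S₃ hS₃ hT₃ => ?_
    have hh : ∀ t < 3 * s, ∀ i, ((b * a ^ t) %ₘ f).coeff i ∈ S₃ := fun t ht i =>
      hS₃ (hT₂ _ ⟨t, ht, i, rfl⟩)
    have hr : ∀ t < 3 * s, ∀ i < 2 * δ, residueInf f (X ^ i * ((b * a ^ t) %ₘ f)) ∈ S₃ :=
      fun t ht i hi => hT₃ _ ⟨t, ht, i, hi, rfl⟩
    have hS03 : S ≤ S₃ := hS₁.trans (hS₂.trans hS₃)
    refine (hcomb 0 S₃ hS03 (by omega) hh hr).bind fun S₄ hS₄ hT₄ => ?_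
    refine (hcomb s S₄ (hS03.trans hS₄) (by omega) (fun t ht i => hS₄ (hh t ht i))
      fun t ht i hi => hS₄ (hr t ht i hi)).bind fun S₅ hS₅ hT₅ => ?_
    have hS05 : S ≤ S₅ := hS03.trans (hS₄.trans hS₅)
    refine (h.truncatedCombinations hf hn (fun i => hS05 (hfS i)) hc (by omega) (by omega) hDδ
      (g := A) (E := E) hA (fun j hj u hu i => hS05 (hAS j hj u hu i))
      (fun l _ t _ => degree_modByMonic_lt_natDegree hf _) (fun l hl t ht i hi => ?_)
      fun l hl t ht i hi => ?_).mono_right ?_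
    · rcases lt_or_ge t s with hts | hts
      · exact hS₅ (hT₄ _ ⟨l, hl, t, hts, Or.inl ⟨i, hi, rfl⟩⟩)
      · exact hT₅ _ ⟨l, hl, t - s, by omega, Or.inl ⟨i, hi, by rw [Nat.sub_add_cancel hts]⟩⟩
    · rcases lt_or_ge t s with hts | hts
      · exact hS₅ (hT₄ _ ⟨l, hl, t, hts, Or.inr ⟨i, hi, rfl⟩⟩)
      · exact hT₅ _ ⟨l, hl, t - s, by omega, Or.inr ⟨i, hi, by rw [Nat.sub_add_cancel hts]⟩⟩
    · rintro _ ⟨k, hk, e, he, rfl⟩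
      have hj : k / s % s < s := Nat.mod_lt _ hs
      have hi : k % s < s := Nat.mod_lt _ hs
      have hl : k / s / s < s := by
        rw [Nat.div_div_eq_div_mul]
        exact Nat.div_lt_of_lt_mul (by rwa [← pow_two, ← pow_succ])
      have hk' : k = k % s + k / s % s * s + k / s / s * s ^ 2 := by
        have h1 := Nat.mod_add_div k s
        have h2 := Nat.mod_add_div (k / s) s
        calc k = k % s + s * (k / s % s + s * (k / s / s)) := by rw [h2, h1]
          _ = _ := by ring
      refine ⟨_, hj, _, hl, _, hi, e, he, ?_⟩
      conv_rhs => rw [hk', mul_pow_modByMonic_eq hf (hA' _ hj) (hB' _ hl)]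
  · exact truncatedPowers_cost_le hs hsc hnδ hDδ'

end TruncatedPowers

/-! ### Degrees of minimal bases -/

section MinimalBases

variable {K : Type*} [Field K]

theorem coeff_colPoly {μ : ℕ} (R : Matrix (Fin μ) (Fin μ) K[X]) (i j : Fin μ) :
    (colPoly R j).coeff i = R i j := by
  simp [colPoly, finsetSum_coeff, coeff_monomial, Fin.val_inj]

theorem eval_colPoly {μ : ℕ} (R : Matrix (Fin μ) (Fin μ) K[X]) (j : Fin μ) (a : K[X]) :
    (colPoly R j).eval a = ∑ i, R i j * a ^ (i : ℕ) := by
  simp [colPoly, eval_finsetSum]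

/-- The Hermite basis of the module of relations. -/
noncomputable def hermiteBasis (f a : K[X]) (k : ℕ) : Matrix (Fin (k + 1)) (Fin (k + 1)) K[X] :=
  .of fun i j => if i = 0 then if j = 0 then f else -a ^ (j : ℕ) else if i = j then 1 else 0

theorem det_hermiteBasis (f a : K[X]) (k : ℕ) : (hermiteBasis f a k).det = f := by
  rw [Matrix.det_of_isUpperTriangular, Fin.prod_univ_succ]
  · simp [hermiteBasis]
  · intro i j hij
    have h0 : i ≠ 0 := by rintro rfl; simp at hij
    have h1 : i ≠ j := by rintro rfl; simp at hij
    simp [hermiteBasis, h0, h1]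

theorem colPoly_hermiteBasis_mem (f a : K[X]) (k : ℕ) (j : Fin (k + 1)) :
    colPoly (hermiteBasis f a k) j ∈ relationModule f a (k + 1) := by
  refine ⟨?_, ?_⟩
  · refine (degree_sum_le _ _).trans_lt ((Finset.sup_lt_iff (WithBot.bot_lt_coe _)).2 fun i _ => ?_)
    exact (degree_monomial_le _ _).trans_lt (by exact_mod_cast i.2)
  · rw [eval_colPoly, Fin.sum_univ_succ]
    rcases eq_or_ne j 0 with rfl | hj
    · simp [hermiteBasis, Fin.succ_ne_zero]
    · obtain ⟨j, rfl⟩ := Fin.exists_succ_eq.2 hj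
      simp [hermiteBasis]

/-- `R` and the Hermite basis, of determinant `f`, are multiples of each other, so `R.det` and `f`
divide one another. Column reducedness reads the degree of `R.det` off the columns. -/
theorem IsMinimalBasis.natDegree_eq {f a : K[X]} {μ : ℕ} (hμ : 0 < μ)
    {R : Matrix (Fin μ) (Fin μ) K[X]} (hR : IsMinimalBasis f a R) :
    f.natDegree = ∑ j, colDegree R j := by
  obtain ⟨k, rfl⟩ : ∃ k, μ = k + 1 := ⟨μ - 1, by omega⟩
  obtain ⟨-, hspan, -, hdet⟩ := hR
  have hdiv : ∀ j, f ∣ ∑ i, R i j * a ^ (i : ℕ) := by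
    intro j
    rw [← eval_colPoly]
    have : colPoly R j ∈ relationModule f a (k + 1) := hspan ▸ Submodule.subset_span ⟨j, rfl⟩
    exact this.2
  choose g hg using hdiv
  have h1 : R = hermiteBasis f a k * .of fun i j => if i = 0 then g j else R i j := by
    ext1 i j
    rw [Matrix.mul_apply, Fin.sum_univ_succ]
    refine Fin.cases ?_ (fun i => ?_) i
    · have h := hg j
      rw [Fin.sum_univ_succ] at h
      simp [hermiteBasis, Fin.succ_ne_zero] at h ⊢
      rw [← h]
      simp [mul_comm]
    · simp [hermiteBasis, Fin.succ_ne_zero]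
  have h2 : ∀ j, ∃ c : Fin (k + 1) → K[X], ∑ l, c l • colPoly R l =
      colPoly (hermiteBasis f a k) j :=
    fun j => (Submodule.mem_span_range_iff_exists_fun _).1
      (hspan ▸ colPoly_hermiteBasis_mem f a k j)
  choose c hc using h2
  have h3 : hermiteBasis f a k = R * .of fun l j => c j l := by
    ext1 i j
    rw [← coeff_colPoly (hermiteBasis f a k), ← hc, finsetSum_coeff, Matrix.mul_apply]
    refine Finset.sum_congr rfl fun l _ => ?_
    rw [coeff_smul, coeff_colPoly, Matrix.of_apply, smul_eq_mul, mul_comm]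
  have hR0 : R.det ≠ 0 := by
    intro h
    rw [h, degree_zero] at hdet
    exact WithBot.bot_ne_coe hdet
  have hd1 : f ∣ R.det := by
    rw [h1, Matrix.det_mul, det_hermiteBasis]
    exact dvd_mul_right _ _
  have hd2 : R.det ∣ f := by
    conv_rhs => rw [← det_hermiteBasis f a k, h3, Matrix.det_mul]
    exact dvd_mul_right _ _
  rw [← natDegree_eq_of_degree_eq_some hdet]
  refine le_antisymm (natDegree_le_of_dvd hd1 hR0) (natDegree_le_of_dvd hd2 ?_)
  rintro rfl
  exact hR0 (zero_dvd_iff.1 hd1)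

theorem IsMinimalBasis.natDegree_le {f a : K[X]} {μ : ℕ} (hμ : 0 < μ)
    {R : Matrix (Fin μ) (Fin μ) K[X]} (hR : IsMinimalBasis f a R) :
    f.natDegree ≤ μ * matDegree R := by
  rw [hR.natDegree_eq hμ]
  refine (Finset.sum_le_card_nsmul _ _ (matDegree R) fun j _ =>
    Finset.le_sup (f := colDegree R) (Finset.mem_univ j)).trans ?_
  simp

theorem IsMinimalBasis.matDegree_le {f a : K[X]} {μ : ℕ} (hμ : 0 < μ)
    {R : Matrix (Fin μ) (Fin μ) K[X]} (hR : IsMinimalBasis f a R) :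
    matDegree R ≤ f.natDegree := by
  rw [hR.natDegree_eq hμ]
  exact Finset.sup_le fun j _ =>
    Finset.single_le_sum (f := colDegree R) (fun _ _ => Nat.zero_le _) (Finset.mem_univ j)

end MinimalBases

/-! ### Families of polynomials -/

section Families

variable {K Ω : Type*} [Field K]

/-- A family of polynomials of degree less than `N`, as a polynomial over the ring of families. -/
noncomputable def familyPoly (N : ℕ) (p : Ω → K[X]) : (Ω → K)[X] :=
  ∑ i ∈ Finset.range N, monomial i fun x => (p x).coeff i

theorem coeff_familyPoly (N : ℕ) (p : Ω → K[X]) (i : ℕ) :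
    (familyPoly N p).coeff i = if i < N then fun x => (p x).coeff i else 0 := by
  simp [familyPoly, finsetSum_coeff, coeff_monomial]

theorem degree_familyPoly_lt (N : ℕ) (p : Ω → K[X]) : (familyPoly N p).degree < N := by
  rw [degree_lt_iff_coeff_zero]
  intro i hi
  rw [coeff_familyPoly, if_neg (by omega)]

theorem map_familyPoly {N : ℕ} {p : Ω → K[X]} (hp : ∀ x, (p x).degree < N) (x : Ω) :
    (familyPoly N p).map (Pi.evalRingHom (fun _ => K) x) = p x := by
  ext i
  rw [coeff_map, coeff_familyPoly]
  split_ifs with h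
  · rfl
  · rw [map_zero, coeff_eq_zero_of_degree_lt ((hp x).trans_le (by exact_mod_cast not_lt.1 h))]

/-- The remainder by a monic polynomial commutes with evaluation at `x`, and vanishes if it does at
every `x`. -/
theorem dvd_of_forall_map_dvd {f p : (Ω → K)[X]} (hf : f.Monic)
    (h : ∀ x, f.map (Pi.evalRingHom (fun _ => K) x) ∣ p.map (Pi.evalRingHom (fun _ => K) x)) :
    f ∣ p := by
  rw [← modByMonic_eq_zero_iff_dvd hf]
  ext i x
  have h1 := (modByMonic_eq_zero_iff_dvd (hf.map (Pi.evalRingHom (fun _ => K) x))).2 (h x)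
  rw [← map_modByMonic _ hf] at h1
  simpa using congrArg (coeff · i) h1

theorem monic_familyPoly [Nonempty Ω] {n : ℕ} {p : Ω → K[X]} (hp : ∀ x, (p x).coeff n = 1) :
    (familyPoly (n + 1) p).Monic ∧ (familyPoly (n + 1) p).natDegree = n := by
  have h1 : (familyPoly (n + 1) p).coeff n = 1 := by
    rw [coeff_familyPoly, if_pos (by omega)]
    exact funext hp
  have h2 : (familyPoly (n + 1) p).natDegree ≤ n :=
    natDegree_le_iff_coeff_eq_zero.2 fun i hi => by rw [coeff_familyPoly, if_neg (by omega)]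
  exact ⟨monic_of_natDegree_le_of_coeff_eq_one n h2 h1,
    natDegree_eq_of_le_of_coeff_ne_zero h2 (by rw [h1]; exact one_ne_zero)⟩

end Families

/-! ### All instances at once -/

section Instances

variable {K : Type*} [Field K]

/-- The instances of the problem of truncated powers. -/
structure PowersInstance (K : Type*) [Field K] (n μ δ : ℕ) where
  f : K[X]
  a : K[X]
  b : K[X]
  A : Fin μ → K[X][X]
  B : Fin μ → K[X][X]
  degree_f : f.degree = (n : WithBot ℕ)
  degree_a : a.degree < (n : WithBot ℕ)
  degree_b : b.degree < (n : WithBot ℕ)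
  exists_basis : ∃ R : Matrix (Fin μ) (Fin μ) K[X], IsMinimalBasis f a R ∧ matDegree R = δ
  hA : ∀ j : Fin μ, BidegreeLT (A j) δ μ ∧ f ∣ (A j).eval a - a ^ ((j : ℕ) * μ)
  hB : ∀ j : Fin μ, BidegreeLT (B j) δ μ ∧ f ∣ (B j).eval a - a ^ ((j : ℕ) * μ ^ 2)

theorem dvd_sum_familyPoly {Ω : Type*} {n μ δ e : ℕ} {f a : Ω → K[X]}
    {F : (Ω → K)[X]} (hF : F.Monic)
    (hFf : ∀ x, ∃ c : K, c ≠ 0 ∧ F.map (Pi.evalRingHom (fun _ => K) x) = C c * f x)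
    (ha : ∀ x, (a x).degree < n) {A : Ω → K[X][X]} (hA : ∀ x, BidegreeLT (A x) δ μ)
    (h : ∀ x, f x ∣ (A x).eval (a x) - a x ^ e) :
    F ∣ ∑ u ∈ Finset.range μ, familyPoly δ (fun x => (A x).coeff u) * familyPoly n a ^ u -
      familyPoly n a ^ e := by
  refine dvd_of_forall_map_dvd hF fun x => ?_
  obtain ⟨c, hc, hx⟩ := hFf x
  have h1 := h x
  rw [eq_sum_monomial_of_degree_lt (hA x).1] at h1
  simp only [eval_finsetSum, eval_monomial] at h1
  simp only [Polynomial.map_sub, Polynomial.map_sum, Polynomial.map_mul, Polynomial.map_pow,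
    map_familyPoly ha, map_familyPoly fun x => (hA x).2 _]
  rw [hx]
  exact (isUnit_C.2 hc.isUnit).mul_left_dvd.2 h1

end Instances

/-- The minimal basis enters the algorithm only through these two inequalities: the first pays for
the initial powers, the second bounds the precision. -/
theorem PowersInstance.bounds {K : Type*} [Field K] {n μ δ : ℕ} (hμ : 0 < μ)
    (x : PowersInstance K n μ δ) : n ≤ μ * δ ∧ δ ≤ n := by
  obtain ⟨R, hR, rfl⟩ := x.exists_basis
  rw [← natDegree_eq_of_degree_eq_some x.degree_f]
  exact ⟨hR.natDegree_le hμ, hR.matDegree_le hμ⟩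

theorem PowersInstance.leadingCoeff_f {K : Type*} [Field K] {n μ δ : ℕ}
    (x : PowersInstance K n μ δ) : x.f.leadingCoeff = x.f.coeff n := by
  rw [leadingCoeff, natDegree_eq_of_degree_eq_some x.degree_f]

theorem PowersInstance.f_ne_zero {K : Type*} [Field K] {n μ δ : ℕ}
    (x : PowersInstance K n μ δ) : x.f ≠ 0 := by
  intro h0
  have := x.degree_f
  rw [h0, degree_zero] at this
  exact WithBot.bot_ne_coe this

/-- The computation of truncated powers, on all instances simultaneously. -/
theorem SeriesOpBound.truncatedPowers_instances {K : Type u} [Field K] {n m μ δ c τ : ℕ}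
    [Nonempty (PowersInstance K n μ δ)] (h : SeriesOpBound.{u} K (4 * n) τ) (hτ : 0 < τ)
    (hc : ∀ (V : Type u) [CommRing V] [Algebra K V], MatMulCost K V μ c) (hμc : μ * μ ≤ c)
    (hμ : 0 < μ) (hμn : μ ≤ n) (hm : 0 < m) (hmn : m ≤ n) :
    (Known.ofSet (Set.range fun (i : PowersInput n μ δ) (x : PowersInstance K n μ δ) =>
        powersInput x.f x.a x.b x.A x.B i) :
      Known K (PowersInstance K n μ δ → K)).Yields (38 * (c * (δ + m * μ) * (τ * τ)))
      {v | ∃ k < μ ^ 3, ∃ e < m, (fun x => ((x.b * x.a ^ k) % x.f).coeff e) = v} := by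
  obtain ⟨hnδ, hδn⟩ := (Classical.arbitrary (PowersInstance K n μ δ)).bounds hμ
  set Ω := PowersInstance K n μ δ with hΩ
  set S : Known K (Ω → K) := Known.ofSet (Set.range fun i (x : Ω) =>
    powersInput x.f x.a x.b x.A x.B i)
    with hS
  have hin : ∀ i : PowersInput n μ δ, (fun x : Ω => powersInput x.f x.a x.b x.A x.B i) ∈ S :=
    fun i => Or.inr ⟨i, rfl⟩
  have hlc : ∀ x : Ω, x.f.coeff n ≠ 0 := fun x => by
    rw [← x.leadingCoeff_f]
    exact leadingCoeff_ne_zero.2 x.f_ne_zero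
  set p : Ω → K[X] := fun x => C (x.f.coeff n)⁻¹ * x.f with hp
  have hpd : ∀ x, (p x).degree < (n + 1 : ℕ) := fun x => by
    rw [hp]
    simp only
    rw [← smul_eq_C_mul]
    refine (degree_smul_le _ _).trans_lt ?_
    rw [x.degree_f]
    exact_mod_cast Nat.lt_succ_self n
  obtain ⟨hF, hFn⟩ := monic_familyPoly (n := n) (p := p) fun x => by
    simp [hp, hlc x]
  set F := familyPoly (n + 1) p with hFdef
  have hFx : ∀ x : Ω, ∃ c : K, c ≠ 0 ∧ F.map (Pi.evalRingHom (fun _ => K) x) = C c * x.f := fun x =>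
    ⟨_, inv_ne_zero (hlc x), map_familyPoly hpd x⟩
  have hF1 : S.Yields (n + 1) {v | ∃ i < n + 1, F.coeff i = v} := by
    refine ((Known.Yields.range (S := S) (n := 1) (n + 1) (T := fun i => {F.coeff i})
      fun i hi => ?_).mono_cost (by omega)).mono_right ?_
    -- The leading coefficient vanishes at no instance, so it is a unit of `Ω → K` and `f` can be
    -- made monic uniformly.
    · have hu : IsUnit fun x : Ω => x.f.coeff n := Pi.isUnit_iff.2 fun x => (hlc x).isUnit
      refine Known.Yields.op .div (x := fun x : Ω => x.f.coeff i) (y := fun x : Ω => x.f.coeff n)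
        (hin (.f ⟨i, hi⟩)) (hin (.f ⟨n, by omega⟩)) ?_
      simp only [ArithOp.apply]
      rw [if_pos hu]
      congr 1
      symm
      rw [Ring.eq_mul_inverse_iff_mul_eq _ _ _ hu, hFdef, coeff_familyPoly, if_pos hi]
      funext x
      simp [hp, hlc x, mul_right_comm]
    · rintro _ ⟨i, hi, rfl⟩
      exact ⟨i, hi, rfl⟩
  have hcoeff : ∀ (N : ℕ) (q : Ω → K[X]), (∀ i < N, (fun x => (q x).coeff i) ∈ S) →
      ∀ i, (familyPoly N q).coeff i ∈ S := fun N q hq i => by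
    rw [coeff_familyPoly]
    split_ifs with hi
    exacts [hq i hi, S.zero_mem]
  set A' : ℕ → ℕ → (Ω → K)[X] := fun j u =>
    if hj : j < μ then familyPoly δ fun x => (x.A ⟨j, hj⟩).coeff u else 0 with hA'
  set B' : ℕ → ℕ → (Ω → K)[X] := fun j u =>
    if hj : j < μ then familyPoly δ fun x => (x.B ⟨j, hj⟩).coeff u else 0 with hB'
  have hmain := hF1.bind fun S₁ hS₁ hT₁ =>
    h.truncatedPowers (S := S₁) (f := F) (s := μ) (c := c) (m := m) (δ := δ) hF hFn
      (Known.coeff_mem (degree_familyPoly_lt _ _) fun i hi => hT₁ _ ⟨i, hi, rfl⟩)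
      hc hμc hμ hμn hm hmn hδn hnδ (a := familyPoly n fun x : Ω => x.a)
      (b := familyPoly n fun x : Ω => x.b) (A := A') (B := B')
      (degree_familyPoly_lt _ _) (fun i => hS₁ (hcoeff _ _ (fun i hi => hin (.a ⟨i, hi⟩)) i))
      (degree_familyPoly_lt _ _) (fun i => hS₁ (hcoeff _ _ (fun i hi => hin (.b ⟨i, hi⟩)) i))
      (fun j hj u _ => by simp only [hA', dif_pos hj]; exact degree_familyPoly_lt _ _)
      (fun j hj u hu i => by
        simp only [hA', dif_pos hj]
        exact hS₁ (hcoeff _ _ (fun i hi => hin (.A ⟨j, hj⟩ ⟨i, hi⟩ ⟨u, hu⟩)) i))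
      (fun j hj u _ => by simp only [hB', dif_pos hj]; exact degree_familyPoly_lt _ _)
      (fun j hj u hu i => by
        simp only [hB', dif_pos hj]
        exact hS₁ (hcoeff _ _ (fun i hi => hin (.B ⟨j, hj⟩ ⟨i, hi⟩ ⟨u, hu⟩)) i))
      (fun j hj => by
        simp only [hA', dif_pos hj]
        exact dvd_sum_familyPoly hF hFx (fun x => x.degree_a) (fun x => (x.hA ⟨j, hj⟩).1)
          fun x => (x.hA ⟨j, hj⟩).2)
      (fun j hj => by
        simp only [hB', dif_pos hj]
        exact dvd_sum_familyPoly hF hFx (fun x => x.degree_a) (fun x => (x.hB ⟨j, hj⟩).1)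
          fun x => (x.hB ⟨j, hj⟩).2)
  refine (hmain.mono_cost ?_).mono_right ?_
  · have h1 : n + 1 ≤ 3 * (c * (δ + m * μ) * (τ * τ)) := by
      have h2 : μ * δ ≤ c * (δ + m * μ) * (τ * τ) :=
        calc μ * δ = μ * δ * (1 * 1) := by ring
          _ ≤ c * (δ + m * μ) * (τ * τ) := by
            gcongr
            · exact (Nat.le_mul_self μ).trans hμc
            · omega
            · exact hτ
            · exact hτ
      omega
    omega
  · rintro _ ⟨k, hk, e, he, rfl⟩
    refine ⟨k, hk, e, he, ?_⟩
    funext x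
    have h1 := map_modByMonic (Pi.evalRingHom (fun _ => K) x)
      (p := (familyPoly n fun x : Ω => x.b) *
      (familyPoly n fun x : Ω => x.a) ^ k) hF
    rw [Polynomial.map_mul, Polynomial.map_pow, map_familyPoly (fun x => x.degree_b),
      map_familyPoly (fun x => x.degree_a), hFdef, map_familyPoly hpd] at h1
    have h2 := congrArg (coeff · e) h1
    simp only [coeff_map] at h2
    rw [mod_def, x.leadingCoeff_f, mul_comm x.f]
    exact h2

/-! ### The final bound -/

theorem exists_log_bound : ∃ κ : ℝ, 0 < κ ∧ ∀ n : ℕ, 0 < n →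
    ((Nat.log 2 (4 * n) + 1 : ℕ) : ℝ) ≤ κ * Real.log (n + 2) := by
  have hl2 : 0 < Real.log 2 := Real.log_pos (by norm_num)
  refine ⟨4 / Real.log 2, by positivity, fun n hn => ?_⟩
  have hn1 : (1 : ℝ) ≤ n := by exact_mod_cast hn
  have h1 : ((2 : ℝ) ^ (Nat.log 2 (4 * n) + 1)) ≤ ((n : ℝ) + 2) ^ 4 := by
    have h2 : 2 ^ Nat.log 2 (4 * n) ≤ 4 * n := Nat.pow_log_le_self 2 (by omega)
    have h3 : (2 : ℝ) ^ Nat.log 2 (4 * n) ≤ 4 * n := by exact_mod_cast h2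
    rw [pow_succ]
    have h4 : (9 : ℝ) ≤ ((n : ℝ) + 2) ^ 2 := by nlinarith
    nlinarith [sq_nonneg ((n : ℝ) + 2)]
  have h5 := Real.log_le_log (by positivity) h1
  rw [Real.log_pow, Real.log_pow] at h5
  rw [div_mul_eq_mul_div, le_div_iff₀ hl2]
  exact_mod_cast h5

theorem SLP.exists_of_isEmpty {K ι κ Ω : Type*} [Field K] (inp : Ω → ι → K) (out : Ω → κ → K)
    (h : IsEmpty κ ∨ IsEmpty Ω) : ∃ P : SLP K ι κ, P.cost = 0 ∧ ∀ x, P.Computes (inp x) (out x) :=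
  ⟨⟨[], fun _ => .const 0⟩, rfl, fun x => ⟨[], rfl, fun k => h.elim (fun h => h.elim k) fun h =>
    h.elim x⟩⟩

theorem mainTheorem6 {K : Type*} [Field K] (ω : ℝ) (hω : IsMatMulExponent K ω) :
    ∃ (C : ℝ) (c : ℕ), ∀ n m d μ δ : ℕ, (d : ℝ) ^ (1 / 3 : ℝ) ≤ (μ : ℝ) → μ ≤ n →
      ∃ P : SLP K (PowersInput n μ δ) (Fin d × Fin m),
        (P.cost : ℝ) ≤
          C * ((μ : ℝ) ^ ω * ((δ : ℝ) + (m : ℝ) * (μ : ℝ))) * Real.log ((n : ℝ) + 2) ^ c ∧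
        ∀ (f a b : K[X]) (R : Matrix (Fin μ) (Fin μ) K[X]) (A B : Fin μ → K[X][X]),
          f.degree = (n : WithBot ℕ) → a.degree < (n : WithBot ℕ) → b.degree < (n : WithBot ℕ) →
          IsMinimalBasis f a R → matDegree R = δ →
          (∀ j : Fin μ, BidegreeLT (A j) δ μ ∧ f ∣ (A j).eval a - a ^ ((j : ℕ) * μ)) →
          (∀ j : Fin μ, BidegreeLT (B j) δ μ ∧ f ∣ (B j).eval a - a ^ ((j : ℕ) * μ ^ 2)) →
          P.Computes (powersInput f a b A B)
            (fun p => ((b * a ^ (p.1 : ℕ)) % f).coeff (p.2 : ℕ)) := by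
  obtain ⟨C₁, c, hc⟩ := hω.exists_matMulCost
  obtain ⟨C₂, hC₂⟩ := exists_seriesOpCost K
  obtain ⟨κ, hκ, hlog⟩ := exists_log_bound
  have hC₁ : 0 ≤ C₁ := by
    have h1 := (hc 1 one_pos).1
    rw [Nat.cast_one, Real.one_rpow, mul_one] at h1
    exact (Nat.cast_nonneg _).trans h1
  -- `38` is `35` for the monic case plus `3` for normalizing `f`; `24` is twice `12`, since `τ`
  -- enters squared.
  refine ⟨38 * C₁ * ((C₂ + 1) * κ ^ 12) ^ 2, 24, fun n m d μ δ hd hμn => ?_⟩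
  have hL : 0 ≤ Real.log ((n : ℝ) + 2) := Real.log_nonneg (by linarith [Nat.cast_nonneg (α := ℝ) n])
  have hd3 : d ≤ μ ^ 3 := by
    have h1 : ((d : ℝ) ^ (1 / 3 : ℝ)) ^ 3 ≤ (μ : ℝ) ^ 3 := by gcongr
    rw [← Real.rpow_natCast, ← Real.rpow_mul (Nat.cast_nonneg d)] at h1
    norm_num at h1
    exact_mod_cast h1
  suffices h : ∃ P : SLP K (PowersInput n μ δ) (Fin d × Fin m),
      (P.cost : ℝ) ≤ 38 * C₁ * ((C₂ + 1) * κ ^ 12) ^ 2 *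
        ((μ : ℝ) ^ ω * ((δ : ℝ) + (m : ℝ) * (μ : ℝ))) * Real.log ((n : ℝ) + 2) ^ 24 ∧
      ∀ x : PowersInstance K n μ δ, P.Computes (powersInput x.f x.a x.b x.A x.B)
        fun p => ((x.b * x.a ^ (p.1 : ℕ)) % x.f).coeff (p.2 : ℕ) by
    obtain ⟨P, hP, hP'⟩ := h
    exact ⟨P, hP, fun f a b R A B hf ha hb hR hδ hA hB =>
      hP' ⟨f, a, b, A, B, hf, ha, hb, ⟨R, hR, hδ⟩, hA, hB⟩⟩
  by_cases htriv : IsEmpty (Fin d × Fin m) ∨ IsEmpty (PowersInstance K n μ δ)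
  · obtain ⟨P, hP, hP'⟩ := SLP.exists_of_isEmpty (K := K)
      (fun x : PowersInstance K n μ δ => powersInput x.f x.a x.b x.A x.B)
      (fun x p => ((x.b * x.a ^ (p.1 : ℕ)) % x.f).coeff (p.2 : ℕ)) htriv
    refine ⟨P, ?_, hP'⟩
    rw [hP, Nat.cast_zero]
    positivity
  rw [not_or, not_isEmpty_iff, not_isEmpty_iff] at htriv
  obtain ⟨⟨k₀, e₀⟩, hΩ⟩ := htriv
  have hm : 0 < m := Nat.zero_lt_of_lt e₀.2
  have hμ : 0 < μ := by
    rcases Nat.eq_zero_or_pos μ with rfl | h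
    · exact absurd (k₀.2.trans_le hd3) (by simp)
    · exact h
  have hn : 0 < n := by omega
  obtain ⟨hc1, hc2, hc3⟩ := hc μ hμ
  obtain ⟨τ, hτ⟩ : ∃ τ, τ = (C₂ + 1) * (Nat.log 2 (4 * n) + 1) ^ 12 := ⟨_, rfl⟩
  have hτ0 : 0 < τ := hτ ▸ by positivity
  have hop : SeriesOpBound K (4 * n) τ := fun N hN V _ _ S o x y z hz hx hy =>
    (hC₂ (4 * n) N hN V S o x y z hz hx hy).mono_cost
      (Nat.mul_le_mul_left _ (hτ ▸ Nat.mul_le_mul_right _ (Nat.le_succ _)))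
  -- Coefficients of index at least `n` of a remainder are zero, so `m` may be replaced by `min m
  -- n`, keeping all precisions below `4 * n`.
  have hyields := hop.truncatedPowers_instances (m := min m n) (δ := δ) hτ0 hc3 hc2 hμ hμn
    (lt_min hm hn) (min_le_right _ _)
  obtain ⟨P, hP, hP'⟩ := Known.Yields.exists_slp
    (out := fun (p : Fin d × Fin m) (x : PowersInstance K n μ δ) =>
      ((x.b * x.a ^ (p.1 : ℕ)) % x.f).coeff (p.2 : ℕ)) (hyields.mono_right_or (by
    rintro _ ⟨⟨k, e⟩, rfl⟩
    rcases lt_or_ge (e : ℕ) n with he | he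
    · exact Or.inl ⟨k, k.2.trans_le hd3, e, lt_min e.2 he, rfl⟩
    · right
      convert Known.zero_mem _ using 1
      funext x
      refine coeff_eq_zero_of_degree_lt ((EuclideanDomain.mod_lt _ x.f_ne_zero).trans_le ?_)
      rw [x.degree_f]
      exact_mod_cast he))
  refine ⟨P, ?_, fun x => hP'.map (Pi.evalAlgHom K (fun _ => K) x)⟩
  obtain ⟨Y, hY⟩ : ∃ Y, Y = (C₂ + 1) * κ ^ 12 * Real.log ((n : ℝ) + 2) ^ 12 := ⟨_, rfl⟩
  have hτR : (τ : ℝ) ≤ Y := by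
    rw [hτ, hY, mul_assoc, ← mul_pow]
    have := hlog n hn
    push_cast at this ⊢
    gcongr
  have hY0 : 0 ≤ Y := (Nat.cast_nonneg _).trans hτR
  have hcμ : 0 ≤ C₁ * (μ : ℝ) ^ ω := (Nat.cast_nonneg _).trans hc1
  have hsum : 0 ≤ (δ : ℝ) + m * μ := by positivity
  have hmin : (δ : ℝ) + (min m n : ℕ) * μ ≤ δ + m * μ :=
    add_le_add le_rfl (mul_le_mul_of_nonneg_right (Nat.cast_le.2 (min_le_left m n))
      (Nat.cast_nonneg _))
  have hmin0 : 0 ≤ (δ : ℝ) + (min m n : ℕ) * μ := by positivity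
  calc (P.cost : ℝ) ≤ ((38 * (c μ * (δ + min m n * μ) * (τ * τ)) : ℕ) : ℝ) := Nat.cast_le.2 hP
    _ = 38 * (c μ * (δ + (min m n : ℕ) * μ) * (τ * τ)) := by push_cast; ring
    _ ≤ 38 * (C₁ * (μ : ℝ) ^ ω * (δ + m * μ) * (Y * Y)) :=
      mul_le_mul_of_nonneg_left (mul_le_mul (mul_le_mul hc1 hmin hmin0 hcμ)
        (mul_le_mul hτR hτR (Nat.cast_nonneg _) hY0)
        (mul_nonneg (Nat.cast_nonneg _) (Nat.cast_nonneg _)) (mul_nonneg hcμ hsum)) (by norm_num)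
    _ = _ := by rw [hY]; ring
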